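/- Let $n\ge 1$, let $V:(0,\infty)\to\mathbb C^{n\times n}$ satisfy $V(x)^\dagger=V(x)$ and $\int_0^\infty |V(x)|\,dx<\infty$, and let $A,B\in\mathbb C^{n\times n}$ satisfy $-B^\dagger A+A^\dagger B=0$ and $A^\dagger A+B^\dagger B>0$ ($\dagger$ is the conjugate transpose). Consider $-\psi''+V(x)\psi=k^2\psi$ on $(0,\infty)$ with the selfadjoint boundary condition $-B^\dagger\psi(0)+A^\dagger\psi'(0)=0$; solutions are understood with $\psi,\psi'$ locally absolutely continuous on $[0,\infty)$ and the equation holding almost everywhere. For $k\ne 0$ with $\operatorname{Im}k\ge 0$ let $f(k,x)$ be the Jost solution, i.e. the $n\times n$ matrix solution with $f(k,x)=e^{ikx}[I+o(1)]$ as $x\to+\infty$. Let $\varphi(k,x)$ be the regular solution, i.e. the $n\times n$ matrix solution with $\varphi(k,0)=A$, $\varphi'(k,0)=B$. Let $J(k)=f(-k^*,0)^\dagger B-f'(-k^*,0)^\dagger A$ be the Jost matrix ($k^*$ is the complex conjugate of $k$). Let $k=i\kappa_j$ with $\kappa_j>0$ be a bound state, i.e. $\det J(i\kappa_j)=0$,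 and let $m_j=\dim\operatorname{Ker}J(i\kappa_j)$ be its multiplicity. Let $P_j$ and $Q_j$ be the orthogonal projections of $\mathbb C^n$ onto $\operatorname{Ker}[J(i\kappa_j)^\dagger]$ and $\operatorname{Ker}J(i\kappa_j)$, respectively. Put $$\mathbf B_j=I-P_j+\int_0^\infty P_j f(i\kappa_j,x)^\dagger f(i\kappa_j,x)P_j\,dx,\qquad \mathbf H_j=I-Q_j+\int_0^\infty Q_j\varphi(i\kappa_j,x)^\dagger\varphi(i\kappa_j,x)Q_j\,dx,$$ which are positive definite matrices, and $$\Psi_j(x)=f(i\kappa_j,x)\,\mathbf B_j^{-1/2}P_j,\qquad \Phi_j(x)=\varphi(i\kappa_j,x)\,\mathbf H_j^{-1/2}Q_j .$$ Then there is exactly one matrix $D_j\in\mathbb C^{n\times n}$ (the dependency matrix) such that $\Phi_j(x)=\Psi_j(x)D_j$ for all $x\ge 0$ and $D_j=P_jD_j$. It has the following properties: (b) $D_j=D_jQ_j$; (c) $D_j^\dagger D_j$ is an orthogonal projection, and $D_j^\dagger D_j=Q_j$; (d) $D_jD_j^\dagger$ is an orthogonal projection, and $D_jD_j^\dagger=P_j$;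 (e) $D_j$, $D_j^\dagger$, $P_j$ and $Q_j$ all have rank $m_j$; (f) $D_j^\dagger$ is the Moore–Penrose inverse of $D_j$, i.e. $X=D_j^\dagger$ is the one and only matrix with $D_jXD_j=D_j$, $XD_jX=X$, $(D_jX)^\dagger=D_jX$, $(XD_j)^\dagger=XD_j$; (g) $\Psi_j(x)=\Phi_j(x)D_j^\dagger$ for all $x\ge 0$; (h) $D_jD_j^\dagger D_j=D_j$ and $D_j^\dagger D_jD_j^\dagger=D_j^\dagger$. -/

import Mathlib

open scoped Matrix ComplexOrder MatrixOrder Matrix.Norms.L2Operator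

noncomputable section

namespace MatrixSchrodinger

variable {n : ℕ}

/-- The one-sided derivative of a function on the half line `[0, ∞)`; at an interior point
`x > 0` it is the ordinary derivative, at `x = 0` it is the derivative from the right. -/
def halfLineDeriv (ψ : ℝ → Matrix (Fin n) (Fin n) ℂ) (x : ℝ) : Matrix (Fin n) (Fin n) ℂ :=
  derivWithin ψ (Set.Ici 0) x

/-- `ψ` is an `n × n` matrix solution of `-ψ'' + V ψ = k² ψ` on the half line. As `V` is only
integrable, this has the usual (Carathéodory) meaning: `ψ` is differentiable on `[0, ∞)`, `ψ'` is
locally absolutely continuous, and `ψ'' = V ψ - k² ψ` almost everywhere. The last two conditions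
say exactly that `ψ'` is an indefinite integral of `V ψ - k² ψ`. -/
structure IsSolution (V : ℝ → Matrix (Fin n) (Fin n) ℂ) (k : ℂ)
    (ψ : ℝ → Matrix (Fin n) (Fin n) ℂ) : Prop where
  differentiableOn : DifferentiableOn ℝ ψ (Set.Ici 0)
  deriv_eq : ∀ x : ℝ, 0 ≤ x →
    halfLineDeriv ψ x = halfLineDeriv ψ 0 + ∫ t in (0 : ℝ)..x, (V t * ψ t - k ^ 2 • ψ t)

/-- `f` is a Jost solution at `k`: a solution with `f(x) = e^{ikx} [I + o(1)]` as `x → +∞`. -/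
structure IsJostSolution (V : ℝ → Matrix (Fin n) (Fin n) ℂ) (k : ℂ)
    (f : ℝ → Matrix (Fin n) (Fin n) ℂ) : Prop where
  isSolution : IsSolution V k f
  asymptotics : Filter.Tendsto (fun x : ℝ => Complex.exp (-(Complex.I * k * x)) • f x)
    Filter.atTop (nhds 1)

/-- `φ` is a regular solution at `k`: a solution with `φ(0) = A` and `φ'(0) = B`. -/
structure IsRegularSolution (V : ℝ → Matrix (Fin n) (Fin n) ℂ) (A B : Matrix (Fin n) (Fin n) ℂ)
    (k : ℂ) (φ : ℝ → Matrix (Fin n) (Fin n) ℂ) : Prop where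
  isSolution : IsSolution V k φ
  initial_value : φ 0 = A
  initial_deriv : halfLineDeriv φ 0 = B

/-- The Jost solution `f(k, ·)`: the function on `[0, ∞)` singled out by `IsJostSolution`. (Its
values at negative arguments are irrelevant and never used.) -/
def jostSolution (V : ℝ → Matrix (Fin n) (Fin n) ℂ) (k : ℂ) : ℝ → Matrix (Fin n) (Fin n) ℂ :=
  Classical.epsilon (IsJostSolution V k)

/-- The regular solution `φ(k, ·)`: the function on `[0, ∞)` singled out by `IsRegularSolution`.
(Its values at negative arguments are irrelevant and never used.) -/
def regularSolution (V : ℝ → Matrix (Fin n) (Fin n) ℂ) (A B : Matrix (Fin n) (Fin n) ℂ)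
    (k : ℂ) : ℝ → Matrix (Fin n) (Fin n) ℂ :=
  Classical.epsilon (IsRegularSolution V A B k)

/-- The Jost matrix `J(k) = f(-k*, 0)† B - f'(-k*, 0)† A`. -/
def jostMatrix (V : ℝ → Matrix (Fin n) (Fin n) ℂ) (A B : Matrix (Fin n) (Fin n) ℂ) (k : ℂ) :
    Matrix (Fin n) (Fin n) ℂ :=
  (jostSolution V (-(starRingEnd ℂ k)) 0)ᴴ * B
    - (halfLineDeriv (jostSolution V (-(starRingEnd ℂ k))) 0)ᴴ * A

/-- The kernel of a matrix, as a subspace of `ℂⁿ` with its standard inner product. -/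
def matrixKernel (M : Matrix (Fin n) (Fin n) ℂ) : Submodule ℂ (EuclideanSpace ℂ (Fin n)) :=
  LinearMap.ker (Matrix.toEuclideanLin M)

/-- The matrix, in the standard basis, of the orthogonal projection onto a subspace of `ℂⁿ`. -/
def projectionMatrix (K : Submodule ℂ (EuclideanSpace ℂ (Fin n))) : Matrix (Fin n) (Fin n) ℂ :=
  (Matrix.toEuclideanCLM (n := Fin n) (𝕜 := ℂ)).symm K.starProjection

/-- `P`: the orthogonal projection onto `Ker J(iκ)†`. -/
def projP (V : ℝ → Matrix (Fin n) (Fin n) ℂ) (A B : Matrix (Fin n) (Fin n) ℂ) (κ : ℝ) :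
    Matrix (Fin n) (Fin n) ℂ :=
  projectionMatrix (matrixKernel (jostMatrix V A B (Complex.I * κ))ᴴ)

/-- `Q`: the orthogonal projection onto `Ker J(iκ)`. -/
def projQ (V : ℝ → Matrix (Fin n) (Fin n) ℂ) (A B : Matrix (Fin n) (Fin n) ℂ) (κ : ℝ) :
    Matrix (Fin n) (Fin n) ℂ :=
  projectionMatrix (matrixKernel (jostMatrix V A B (Complex.I * κ)))

/-- The multiplicity `m` of the bound state at `k = iκ`: the dimension of `Ker J(iκ)`. -/
def boundStateMultiplicity (V : ℝ → Matrix (Fin n) (Fin n) ℂ) (A B : Matrix (Fin n) (Fin n) ℂ)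
    (κ : ℝ) :
    ℕ :=
  Module.finrank ℂ (matrixKernel (jostMatrix V A B (Complex.I * κ)))

/-- `𝐁 = I - P + ∫₀^∞ P f(iκ,x)† f(iκ,x) P dx`. -/
def marchenkoGram (V : ℝ → Matrix (Fin n) (Fin n) ℂ) (A B : Matrix (Fin n) (Fin n) ℂ) (κ : ℝ) :
    Matrix (Fin n) (Fin n) ℂ :=
  1 - projP V A B κ + ∫ x in Set.Ioi (0 : ℝ),
    projP V A B κ * (jostSolution V (Complex.I * κ) x)ᴴ * jostSolution V (Complex.I * κ) x
      * projP V A B κ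

/-- `𝐇 = I - Q + ∫₀^∞ Q φ(iκ,x)† φ(iκ,x) Q dx`. -/
def gelfandLevitanGram (V : ℝ → Matrix (Fin n) (Fin n) ℂ) (A B : Matrix (Fin n) (Fin n) ℂ)
    (κ : ℝ) : Matrix (Fin n) (Fin n) ℂ :=
  1 - projQ V A B κ + ∫ x in Set.Ioi (0 : ℝ),
    projQ V A B κ * (regularSolution V A B (Complex.I * κ) x)ᴴ
      * regularSolution V A B (Complex.I * κ) x * projQ V A B κ

/-- The Marchenko normalization matrix `M = 𝐁^{-1/2} P`. -/
def marchenkoNormalization (V : ℝ → Matrix (Fin n) (Fin n) ℂ) (A B : Matrix (Fin n) (Fin n) ℂ)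
    (κ : ℝ) : Matrix (Fin n) (Fin n) ℂ :=
  (CFC.sqrt (marchenkoGram V A B κ))⁻¹ * projP V A B κ

/-- The Gel'fand-Levitan normalization matrix `C = 𝐇^{-1/2} Q`. -/
def gelfandLevitanNormalization (V : ℝ → Matrix (Fin n) (Fin n) ℂ)
    (A B : Matrix (Fin n) (Fin n) ℂ) (κ : ℝ) : Matrix (Fin n) (Fin n) ℂ :=
  (CFC.sqrt (gelfandLevitanGram V A B κ))⁻¹ * projQ V A B κ

/-- The Marchenko normalized bound-state solution `Ψ(x) = f(iκ, x) M`. -/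
def marchenkoSolution (V : ℝ → Matrix (Fin n) (Fin n) ℂ) (A B : Matrix (Fin n) (Fin n) ℂ)
    (κ : ℝ) (x : ℝ) : Matrix (Fin n) (Fin n) ℂ :=
  jostSolution V (Complex.I * κ) x * marchenkoNormalization V A B κ

/-- The Gel'fand-Levitan normalized bound-state solution `Φ(x) = φ(iκ, x) C`. -/
def gelfandLevitanSolution (V : ℝ → Matrix (Fin n) (Fin n) ℂ) (A B : Matrix (Fin n) (Fin n) ℂ)
    (κ : ℝ) (x : ℝ) : Matrix (Fin n) (Fin n) ℂ :=
  regularSolution V A B (Complex.I * κ) x * gelfandLevitanNormalization V A B κ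

/-- `D` is a dependency matrix at `k = iκ`: `Φ(x) = Ψ(x) D` on the half line, and `D = P D`. -/
structure IsDependencyMatrix (V : ℝ → Matrix (Fin n) (Fin n) ℂ)
    (A B : Matrix (Fin n) (Fin n) ℂ) (κ : ℝ) (D : Matrix (Fin n) (Fin n) ℂ) : Prop where
  solution_eq : ∀ x : ℝ, 0 ≤ x → gelfandLevitanSolution V A B κ x = marchenkoSolution V A B κ x * D
  proj_mul : D = projP V A B κ * D

/-- `X` is a Moore-Penrose inverse of `M`: the four Penrose equations hold. -/
structure IsMoorePenroseInverse (M X : Matrix (Fin n) (Fin n) ℂ) : Prop where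
  mul_mul_self : M * X * M = M
  inv_mul_mul : X * M * X = X
  mul_hermitian : (M * X)ᴴ = M * X
  inv_mul_hermitian : (X * M)ᴴ = X * M

end MatrixSchrodinger

end

open MatrixSchrodinger

/-! Write f, φ for the Jost and regular solutions at k = iκ, and J, P, Q for J(iκ) and its two
projections. Since e^{κx} f(x) → I, f decays exponentially, and K = ∫ f†f converges. The Wronskian
f†f' - f'†f is constant (V is Hermitian and k² real) and tends to 0, so it vanishes: the columns of
(f(0), f'(0)) span a Lagrangian, hence maximal isotropic, subspace of ℂ²ⁿ. The identity JQ = 0 says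
that the columns of (AQ, BQ) are symplectically orthogonal to this subspace, so they lie in it: AQ =
f(0)R and BQ = f'(0)R. Uniqueness for the initial value problem gives φQ = fR, and J†R = B†AQ - A†BQ
= 0 gives PR = R. This is `exists_regularSolution_mul_projQ_eq`.

The rest is algebra. The Gram matrices are 𝐁 = I - P + PKP and 𝐇 = I - Q + R†KR. With M = 𝐁^{-1/2}P
and C = 𝐇^{-1/2}Q, `normalization_properties` gives M†KM = P and C†R†KRC = Q. Because f can be
cancelled on the left, the conditions on D amount to MD = RC and D = PD, whose only solution is D =
𝐁^{1/2}RC. Then D†D = D†M†KMD = (RC)†K(RC) = Q. Finally P - DD† is an orthogonal projection, of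
trace zero because J and J† have kernels of equal dimension; so DD† = P, and the remaining claims
follow.

The definitions select f and φ by choice, so existence has to be proved: both come from Volterra
equations with an integrable coefficient, solved by contraction in a weighted norm. Only k = iκ
matters, since -k* = k there. -/

/-! ### Indefinite integrals on the half line and their product rule -/

section Primitive

open MeasureTheory Set

variable {E F G : Type*} [NormedAddCommGroup E] [NormedSpace ℝ E]
  [NormedAddCommGroup F] [NormedSpace ℝ F]
  [NormedAddCommGroup G] [NormedSpace ℝ G]

/-- `u` is an indefinite integral of `a` on the half line `[0, ∞)`. -/
structure IsPrimitive (u a : ℝ → E) : Prop where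
  intervalIntegrable : ∀ x : ℝ, 0 ≤ x → IntervalIntegrable a volume 0 x
  eq : ∀ x : ℝ, 0 ≤ x → u x = u 0 + ∫ t in (0 : ℝ)..x, a t

namespace IsPrimitive

theorem continuousOn {u a : ℝ → E} (h : IsPrimitive u a) : ContinuousOn u (Ici 0) := by
  have h1 : ∀ X : ℝ, 0 ≤ X → ContinuousOn u (Icc 0 X) := by
    intro X hX
    have := intervalIntegral.continuousOn_primitive_interval' (h.intervalIntegrable X hX)
      (left_mem_uIcc)
    rw [uIcc_of_le hX] at this
    exact (continuousOn_const.add this).congr fun x hx => h.eq x hx.1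
  intro x hx
  have h2 := h1 (x + 1) (by have : (0:ℝ) ≤ x := hx; linarith) x ⟨hx, by linarith⟩
  refine h2.mono_of_mem_nhdsWithin ?_
  rw [mem_nhdsWithin]
  exact ⟨Iio (x + 1), isOpen_Iio, by simp, fun y hy => ⟨hy.2, hy.1.le⟩⟩

theorem add {u a v b : ℝ → E} (h : IsPrimitive u a) (k : IsPrimitive v b) :
    IsPrimitive (fun x => u x + v x) (fun x => a x + b x) where
  intervalIntegrable x hx := (h.intervalIntegrable x hx).add (k.intervalIntegrable x hx)
  eq x hx := by
    rw [intervalIntegral.integral_add (h.intervalIntegrable x hx) (k.intervalIntegrable x hx),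
      h.eq x hx, k.eq x hx]
    abel

theorem sub {u a v b : ℝ → E} (h : IsPrimitive u a) (k : IsPrimitive v b) :
    IsPrimitive (fun x => u x - v x) (fun x => a x - b x) where
  intervalIntegrable x hx := (h.intervalIntegrable x hx).sub (k.intervalIntegrable x hx)
  eq x hx := by
    rw [intervalIntegral.integral_sub (h.intervalIntegrable x hx) (k.intervalIntegrable x hx),
      h.eq x hx, k.eq x hx]
    abel

theorem const (c : E) : IsPrimitive (fun _ => c) (fun _ => 0) where
  intervalIntegrable x _ := by simp
  eq x _ := by simp

theorem clm [CompleteSpace E] [CompleteSpace F] (L : E →L[ℝ] F) {u a : ℝ → E}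
    (h : IsPrimitive u a) :
    IsPrimitive (fun x => L (u x)) (fun x => L (a x)) where
  intervalIntegrable x hx := by
    have := h.intervalIntegrable x hx
    exact ⟨L.integrable_comp this.1, L.integrable_comp this.2⟩
  eq x hx := by
    rw [L.intervalIntegral_comp_comm (h.intervalIntegrable x hx), h.eq x hx, map_add]

theorem congr {u a b : ℝ → E} (h : IsPrimitive u a) (hab : ∀ x, 0 < x → a x = b x) :
    IsPrimitive u b where
  intervalIntegrable x hx := (h.intervalIntegrable x hx).congr fun t ht => by
    rw [uIoc_of_le hx] at ht; exact hab t ht.1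
  eq x hx := by
    rw [h.eq x hx]
    congr 1
    refine intervalIntegral.integral_congr_ae (Filter.Eventually.of_forall fun t ht => ?_)
    rw [uIoc_of_le hx] at ht; exact hab t ht.1

theorem congr_left {u v a : ℝ → E} (h : IsPrimitive u a) (huv : ∀ x, 0 ≤ x → u x = v x) :
    IsPrimitive v a where
  intervalIntegrable := h.intervalIntegrable
  eq x hx := by rw [← huv x hx, ← huv 0 le_rfl, h.eq x hx]

theorem of_hasDerivAt [CompleteSpace E] {u a : ℝ → E} (hu : ∀ x, HasDerivAt u (a x) x)
    (ha : Continuous a) : IsPrimitive u a where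
  intervalIntegrable x _ := ha.intervalIntegrable _ _
  eq x _ := by
    rw [intervalIntegral.integral_eq_sub_of_hasDerivAt (fun t _ => hu t)
      (ha.intervalIntegrable _ _)]
    abel

theorem hasDerivWithinAt [CompleteSpace E] {u a : ℝ → E} (h : IsPrimitive u a)
    (ha : ContinuousOn a (Ici 0)) {x : ℝ} (hx : 0 ≤ x) :
    HasDerivWithinAt u (a x) (Ici 0) x := by
  -- Freezing `a` at its value at 0 for t < 0 gives a function continuous on all of ℝ, so the
  -- two-sided fundamental theorem covers x = 0 as well.
  have hc : Continuous fun t : ℝ => a (max t 0) :=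
    ha.comp_continuous (by fun_prop) fun t => le_max_right t 0
  have h1 : HasDerivAt (fun y => u 0 + ∫ t in (0 : ℝ)..y, a (max t 0)) (a (max x 0)) x :=
    (intervalIntegral.integral_hasDerivAt_right (hc.intervalIntegrable _ _)
      (hc.stronglyMeasurableAtFilter _ _) hc.continuousAt).const_add _
  rw [max_eq_left hx] at h1
  have h2 : ∀ y ∈ Ici (0 : ℝ), u y = u 0 + ∫ t in (0 : ℝ)..y, a (max t 0) := by
    intro y hy
    rw [h.eq y hy]
    congr 1
    refine intervalIntegral.integral_congr fun t ht => ?_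
    rw [uIcc_of_le hy] at ht
    simp [ht.1]
  exact h1.hasDerivWithinAt.congr h2 (h2 x hx)

/-- Fubini on the square (0, x]²: the double integral of B(a(t), b(s)) is split along the diagonal
into the triangles s ≤ t and t < s. This replaces differentiation in the product rule, as `a` and
`b` are merely integrable. -/
theorem integral_bilinear [CompleteSpace E] [CompleteSpace F] [CompleteSpace G]
    (B : E →L[ℝ] F →L[ℝ] G) {a : ℝ → E} {b : ℝ → F} {x : ℝ}
    (ha : IntegrableOn a (Ioc 0 x)) (hb : IntegrableOn b (Ioc 0 x)) :
    B (∫ t in Ioc 0 x, a t) (∫ t in Ioc 0 x, b t) =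
      (∫ t in Ioc 0 x, B (a t) (∫ s in Ioc 0 t, b s)) +
      ∫ s in Ioc 0 x, B (∫ t in Ioc 0 s, a t) (b s) := by
  set μ := volume.restrict (Ioc (0:ℝ) x) with hμ
  have hab : Integrable (fun p : ℝ × ℝ => B (a p.1) (b p.2)) (μ.prod μ) := by
    refine Integrable.op_fst_snd (op := fun u v => B u v) (by fun_prop) ⟨‖B‖, B.le_opNorm₂⟩ ha hb
  set K : ℝ × ℝ → G := fun p => B (a p.1) (b p.2) with hK
  set S : Set (ℝ × ℝ) := {p | p.2 ≤ p.1} with hS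
  have hm : MeasurableSet S := measurableSet_le measurable_snd measurable_fst
  have h1 : Integrable (S.indicator K) (μ.prod μ) := hab.indicator hm
  have h2 : Integrable (Sᶜ.indicator K) (μ.prod μ) := hab.indicator hm.compl
  have e1 : ∀ t ∈ Ioc 0 x, B (a t) (∫ s in Ioc 0 t, b s) = ∫ s, S.indicator K (t, s) ∂μ := by
    intro t ht
    have : ∀ s, S.indicator K (t, s) = (Iic t).indicator (fun s => B (a t) (b s)) s := fun s => by
      by_cases hst : s ≤ t <;> simp [indicator, hS, hK, hst]
    simp_rw [this]
    rw [integral_indicator measurableSet_Iic, hμ, Measure.restrict_restrict measurableSet_Iic,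
      ContinuousLinearMap.integral_comp_comm]
    · congr 3
      ext s; simp only [mem_Ioc, mem_inter_iff, mem_Iic]
      constructor
      · rintro ⟨h, h'⟩; exact ⟨h', h, h'.trans ht.2⟩
      · rintro ⟨h, h', _⟩; exact ⟨h', h⟩
    · exact IntegrableOn.mono_set hb fun s hs => hs.2
  have e2 : ∀ s ∈ Ioc 0 x, B (∫ t in Ioc 0 s, a t) (b s) = ∫ t, Sᶜ.indicator K (t, s) ∂μ := by
    intro s hs
    have : ∀ t, Sᶜ.indicator K (t, s) = (Iio s).indicator (fun t => B.flip (b s) (a t)) t :=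
      fun t => by
      by_cases hst : s ≤ t
      · simp [indicator, hS, hst]
      · simp [indicator, hS, hK, hst, not_le.1 hst]
    simp_rw [this]
    rw [integral_indicator measurableSet_Iio, hμ, Measure.restrict_restrict measurableSet_Iio,
      ContinuousLinearMap.integral_comp_comm, ContinuousLinearMap.flip_apply,
      integral_Ioc_eq_integral_Ioo]
    · congr 4
      ext t; simp only [mem_Ioo, mem_inter_iff, mem_Iio, mem_Ioc]
      constructor
      · rintro ⟨h, h'⟩; exact ⟨h', h, h'.le.trans hs.2⟩
      · rintro ⟨h, h', _⟩; exact ⟨h', h⟩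
    · exact IntegrableOn.mono_set ha fun s hs => hs.2
  rw [setIntegral_congr_fun measurableSet_Ioc e1, setIntegral_congr_fun measurableSet_Ioc e2,
    ← integral_integral_swap (f := fun t s => Sᶜ.indicator K (t, s)) h2,
    ← integral_integral_add h1 h2]
  have h4 : ∀ t s, S.indicator K (t, s) + Sᶜ.indicator K (t, s) = B (a t) (b s) := fun t s =>
    indicator_self_add_compl_apply _ _ _
  simp_rw [h4]
  have h5 : ∀ t, ∫ s, B (a t) (b s) ∂μ = B (a t) (∫ s, b s ∂μ) := fun t =>
    ContinuousLinearMap.integral_comp_comm _ hb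
  simp_rw [h5]
  exact (ContinuousLinearMap.integral_comp_comm (B.flip (∫ s, b s ∂μ)) ha).symm

/-- Product rule for absolutely continuous functions: the increments of `u` and `v` are the
integrals of `a` and `b`, so `integral_bilinear` applies once the initial values are split off. -/
theorem bilinear [CompleteSpace E] [CompleteSpace F] [CompleteSpace G]
    (B : E →L[ℝ] F →L[ℝ] G) {u a : ℝ → E} {v b : ℝ → F}
    (hu : IsPrimitive u a) (hv : IsPrimitive v b) :
    IsPrimitive (fun x => B (u x) (v x)) (fun x => B (a x) (v x) + B (u x) (b x)) := by
  have key : ∀ x : ℝ, 0 ≤ x → IntegrableOn (fun t => B (a t) (v t)) (Ioc 0 x) ∧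
      IntegrableOn (fun t => B (u t) (b t)) (Ioc 0 x) := by
    intro x hx
    have ha := (intervalIntegrable_iff_integrableOn_Ioc_of_le hx).1 (hu.intervalIntegrable x hx)
    have hb := (intervalIntegrable_iff_integrableOn_Ioc_of_le hx).1 (hv.intervalIntegrable x hx)
    have hsub : Icc 0 x ⊆ Ici (0:ℝ) := fun t ht => ht.1
    obtain ⟨Cv, hCv⟩ := isCompact_Icc.exists_bound_of_continuousOn (hv.continuousOn.mono hsub)
    obtain ⟨Cu, hCu⟩ := isCompact_Icc.exists_bound_of_continuousOn (hu.continuousOn.mono hsub)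
    have mv : AEStronglyMeasurable v (volume.restrict (Ioc 0 x)) :=
      (hv.continuousOn.mono (Ioc_subset_Icc_self.trans hsub)).aestronglyMeasurable measurableSet_Ioc
    have mu : AEStronglyMeasurable u (volume.restrict (Ioc 0 x)) :=
      (hu.continuousOn.mono (Ioc_subset_Icc_self.trans hsub)).aestronglyMeasurable measurableSet_Ioc
    constructor
    · refine Integrable.mono' (ha.norm.const_mul (‖B‖ * Cv))
        (B.aestronglyMeasurable_comp₂ ha.aestronglyMeasurable mv) ?_
      filter_upwards [ae_restrict_mem measurableSet_Ioc] with t ht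
      calc ‖B (a t) (v t)‖ ≤ ‖B‖ * ‖a t‖ * ‖v t‖ := B.le_opNorm₂ _ _
        _ ≤ ‖B‖ * ‖a t‖ * Cv := by gcongr; exact hCv t (Ioc_subset_Icc_self ht)
        _ = _ := by ring
    · refine Integrable.mono' (hb.norm.const_mul (‖B‖ * Cu))
        (B.aestronglyMeasurable_comp₂ mu hb.aestronglyMeasurable) ?_
      filter_upwards [ae_restrict_mem measurableSet_Ioc] with t ht
      calc ‖B (u t) (b t)‖ ≤ ‖B‖ * ‖u t‖ * ‖b t‖ := B.le_opNorm₂ _ _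
        _ ≤ ‖B‖ * Cu * ‖b t‖ := by gcongr; exact hCu t (Ioc_subset_Icc_self ht)
  refine ⟨fun x hx => ?_, fun x hx => ?_⟩
  · rw [intervalIntegrable_iff_integrableOn_Ioc_of_le hx]
    exact (key x hx).1.add (key x hx).2
  · have ha := (intervalIntegrable_iff_integrableOn_Ioc_of_le hx).1 (hu.intervalIntegrable x hx)
    have hb := (intervalIntegrable_iff_integrableOn_Ioc_of_le hx).1 (hv.intervalIntegrable x hx)
    rw [intervalIntegral.integral_of_le hx, integral_add (key x hx).1 (key x hx).2]
    have i1 : ∀ t ∈ Ioc 0 x, B (a t) (∫ s in Ioc 0 t, b s) = B (a t) (v t) - B.flip (v 0) (a t) := by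
      intro t ht
      rw [hv.eq t ht.1.le, intervalIntegral.integral_of_le ht.1.le, map_add,
        ContinuousLinearMap.flip_apply]
      abel
    have i2 : ∀ t ∈ Ioc 0 x, B (∫ s in Ioc 0 t, a s) (b t) = B (u t) (b t) - B (u 0) (b t) := by
      intro t ht
      rw [hu.eq t ht.1.le, intervalIntegral.integral_of_le ht.1.le, map_add,
        add_apply]
      abel
    have h := integral_bilinear B ha hb
    rw [setIntegral_congr_fun measurableSet_Ioc i1, setIntegral_congr_fun measurableSet_Ioc i2,
      integral_sub (key x hx).1 (ContinuousLinearMap.integrable_comp _ ha),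
      integral_sub (key x hx).2 (ContinuousLinearMap.integrable_comp _ hb),
      ContinuousLinearMap.integral_comp_comm _ ha, ContinuousLinearMap.integral_comp_comm _ hb,
      ContinuousLinearMap.flip_apply] at h
    have e1 := hu.eq x hx
    have e2 := hv.eq x hx
    rw [intervalIntegral.integral_of_le hx] at e1 e2
    rw [e1, e2]
    simp only [map_add, add_apply]
    rw [h]
    abel

theorem smul {u a : ℝ → ℝ} {v b : ℝ → E} [CompleteSpace E]
    (hu : IsPrimitive u a) (hv : IsPrimitive v b) :
    IsPrimitive (fun x => u x • v x) (fun x => a x • v x + u x • b x) :=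
  bilinear (ContinuousLinearMap.lsmul ℝ ℝ) hu hv

theorem mul {𝔸 : Type*} [NormedRing 𝔸] [NormedAlgebra ℝ 𝔸] [CompleteSpace 𝔸]
    {u a v b : ℝ → 𝔸} (hu : IsPrimitive u a) (hv : IsPrimitive v b) :
    IsPrimitive (fun x => u x * v x) (fun x => a x * v x + u x * b x) :=
  bilinear (ContinuousLinearMap.mul ℝ 𝔸) hu hv

end IsPrimitive

end Primitive

/-! ### Gronwall's lemma and Volterra equations with an integrable coefficient -/

section Volterra

open MeasureTheory Set Filter Topology BoundedContinuousFunction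

theorem LipschitzOnWith.comp_absolutelyContinuousOnInterval {X Y : Type*} [PseudoMetricSpace X]
    [PseudoMetricSpace Y] {K : NNReal} {g : X → Y} {s : Set X} (hg : LipschitzOnWith K g s)
    {f : ℝ → X} {a b : ℝ} (hf : AbsolutelyContinuousOnInterval f a b)
    (hs : MapsTo f (uIcc a b) s) : AbsolutelyContinuousOnInterval (fun x => g (f x)) a b := by
  rw [absolutelyContinuousOnInterval_iff] at hf ⊢
  intro ε hε
  obtain ⟨δ, hδ, H⟩ := hf (ε / (K + 1)) (by positivity)
  refine ⟨δ, hδ, fun J hJ hJδ => ?_⟩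
  calc ∑ i ∈ Finset.range J.1, dist (g (f (J.2 i).1)) (g (f (J.2 i).2))
      ≤ ∑ i ∈ Finset.range J.1, K * dist (f (J.2 i).1) (f (J.2 i).2) := by
        refine Finset.sum_le_sum fun i hi => ?_
        exact hg.dist_le_mul _ (hs (hJ.1 i hi).1) _ (hs (hJ.1 i hi).2)
    _ = K * ∑ i ∈ Finset.range J.1, dist (f (J.2 i).1) (f (J.2 i).2) := by rw [Finset.mul_sum]
    _ ≤ K * (ε / (K + 1)) := by gcongr; exact (H J hJ hJδ).le
    _ < (K + 1) * (ε / (K + 1)) := by gcongr; linarith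
    _ = ε := by field_simp

/-- The exponential weight attached to an integrable function `g`. -/
noncomputable def expWeight (g : ℝ → ℝ) (x : ℝ) : ℝ := Real.exp (2 * ∫ t in Iic x, g t)

variable {g : ℝ → ℝ}

theorem expWeight_pos (x : ℝ) : 0 < expWeight g x := Real.exp_pos _

theorem one_le_expWeight (hg : 0 ≤ g) (x : ℝ) : 1 ≤ expWeight g x :=
  Real.one_le_exp (mul_nonneg zero_le_two (integral_nonneg hg))

theorem expWeight_le (hg : 0 ≤ g) (hi : Integrable g) (x : ℝ) :
    expWeight g x ≤ Real.exp (2 * ∫ t, g t) := by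
  refine Real.exp_le_exp.2 (mul_le_mul_of_nonneg_left ?_ zero_le_two)
  exact setIntegral_le_integral hi (Eventually.of_forall hg)

theorem expWeight_eq (hi : Integrable g) (a x : ℝ) :
    expWeight g x = Real.exp (2 * ((∫ t in Iic a, g t) + ∫ t in a..x, g t)) := by
  rw [expWeight, ← intervalIntegral.integral_Iic_sub_Iic hi.integrableOn hi.integrableOn]
  congr 2
  ring

theorem continuous_expWeight (hi : Integrable g) : Continuous (expWeight g) := by
  rw [funext (expWeight_eq hi 0)]
  have := intervalIntegral.continuous_primitive (fun a b => hi.intervalIntegrable) (0 : ℝ)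
  fun_prop

theorem integrable_mul_expWeight (hg : 0 ≤ g) (hi : Integrable g) :
    Integrable fun t => g t * expWeight g t := by
  refine Integrable.mono' (hi.mul_const (Real.exp (2 * ∫ t, g t)))
    (hi.aestronglyMeasurable.mul (continuous_expWeight hi).aestronglyMeasurable) ?_
  refine Eventually.of_forall fun t => ?_
  rw [Real.norm_of_nonneg (mul_nonneg (hg t) (expWeight_pos t).le)]
  exact mul_le_mul_of_nonneg_left (expWeight_le hg hi t) (hg t)

/-- Almost everywhere the weight w satisfies w' = 2gw, so the integral of gw is half an increment of
w. The 2 in the exponent thus produces the factor 1/2 that makes the Volterra operator a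
contraction. -/
theorem integral_mul_expWeight_le (hg : 0 ≤ g) (hi : Integrable g) (x : ℝ) :
    ∫ t in Iic x, g t * expWeight g t ≤ expWeight g x / 2 := by
  have hw := (integrable_mul_expWeight hg hi).integrableOn (s := Iic x)
  refine le_of_tendsto (intervalIntegral_tendsto_integral_Iic x hw tendsto_id) ?_
  filter_upwards [eventually_le_atBot x] with a ha
  have hgi : IntervalIntegrable g volume a x := hi.intervalIntegrable
  have hac : AbsolutelyContinuousOnInterval
      (fun y => 2 * ((∫ t in Iic a, g t) + ∫ t in a..y, g t)) a x := by
    have h1 := hgi.absolutelyContinuousOnInterval_intervalIntegral (c := a) (by simp)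
    have h2 : AbsolutelyContinuousOnInterval (fun _ : ℝ => ∫ t in Iic a, g t) a x :=
      contDiffOn_const.absolutelyContinuousOnInterval
    exact (h2.add h1).const_mul 2
  have hbdd : MapsTo (fun y => 2 * ((∫ t in Iic a, g t) + ∫ t in a..y, g t)) (uIcc a x)
      (Icc 0 (2 * ∫ t, g t)) := by
    intro y _
    have h1 := one_le_expWeight hg y
    have h2 := expWeight_le hg hi y
    rw [expWeight_eq hi a] at h1 h2
    exact ⟨Real.one_le_exp_iff.1 h1, Real.exp_le_exp.1 h2⟩
  -- The exponential is Lipschitz only on bounded sets; the exponent stays in a compact interval, so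
  -- the composition is absolutely continuous and equals the integral of its a.e. derivative.
  obtain ⟨K, hK⟩ := (Real.contDiff_exp (n := 1)).contDiffOn.exists_lipschitzOnWith
    (s := Icc 0 (2 * ∫ t, g t)) (by decide) (convex_Icc _ _) isCompact_Icc
  have hE := hK.comp_absolutelyContinuousOnInterval hac hbdd
  have hF := hE.integral_deriv_eq_sub
  have hae : ∀ᵐ y : ℝ, y ∈ uIoc a x →
      deriv (fun y => Real.exp (2 * ((∫ t in Iic a, g t) + ∫ t in a..y, g t))) y
        = 2 * (g y * expWeight g y) := by
    filter_upwards [hgi.ae_hasDerivAt_integral] with y hy hyx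
    have := (((hy (uIoc_subset_uIcc hyx) a (by simp)).const_add (∫ t in Iic a, g t)).const_mul
      2).exp
    rw [this.deriv, expWeight_eq hi a]
    ring
  rw [intervalIntegral.integral_congr_ae hae, intervalIntegral.integral_const_mul,
    ← expWeight_eq hi] at hF
  have := Real.exp_pos (2 * ((∫ t in Iic a, g t) + ∫ t in a..a, g t))
  simp only [id]
  linarith

/-- Gronwall's lemma with an integrable coefficient and zero initial value. -/
theorem eq_zero_of_le_integral {k y : ℝ → ℝ} {X : ℝ} (hk : 0 ≤ k)
    (hki : IntegrableOn k (Ioc 0 X)) (hy : ContinuousOn y (Icc 0 X)) (hy0 : ∀ x ∈ Icc 0 X, 0 ≤ y x)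
    (hle : ∀ x ∈ Icc 0 X, y x ≤ ∫ t in Ioc 0 x, k t * y t) : ∀ x ∈ Icc 0 X, y x = 0 := by
  intro x hx
  set g : ℝ → ℝ := (Ioc 0 X).indicator k with hgdef
  have hg : 0 ≤ g := fun t => indicator_nonneg (fun t _ => hk t) t
  have hgi : Integrable g := (integrable_indicator_iff measurableSet_Ioc).2 hki
  -- At a maximum point z of y/w, with maximum S, the hypothesis yields y(z) ≤ S w(z)/2, whereas
  -- y(z) = S w(z); hence S = 0.
  obtain ⟨z, hz, hmax⟩ := isCompact_Icc.exists_isMaxOn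
    (nonempty_of_mem hx) (hy.div (continuous_expWeight hgi).continuousOn fun t _ => (expWeight_pos t).ne')
  set S := y z / expWeight g z with hS
  have hyS : ∀ t ∈ Icc 0 X, y t ≤ S * expWeight g t := fun t ht =>
    (div_le_iff₀ (expWeight_pos t)).1 (hmax ht)
  have hS0 : 0 ≤ S := div_nonneg (hy0 z hz) (expWeight_pos z).le
  have h1 : y z ≤ S * (expWeight g z / 2) := by
    calc y z ≤ ∫ t in Ioc 0 z, k t * y t := hle z hz
      _ ≤ ∫ t in Ioc 0 z, S * (g t * expWeight g t) := by
        refine integral_mono_of_nonneg ?_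
          ((integrable_mul_expWeight hg hgi).integrableOn.const_mul S) ?_
        · filter_upwards [ae_restrict_mem measurableSet_Ioc] with t ht
          exact mul_nonneg (hk t) (hy0 t ⟨ht.1.le, ht.2.trans hz.2⟩)
        · filter_upwards [ae_restrict_mem measurableSet_Ioc] with t ht
          have : g t = k t := indicator_of_mem (show t ∈ Ioc 0 X from ⟨ht.1, ht.2.trans hz.2⟩) _
          rw [this, mul_left_comm]
          exact mul_le_mul_of_nonneg_left (hyS t ⟨ht.1.le, ht.2.trans hz.2⟩) (hk t)
      _ = S * ∫ t in Ioc 0 z, g t * expWeight g t := integral_const_mul _ _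
      _ ≤ S * ∫ t in Iic z, g t * expWeight g t := by
        refine mul_le_mul_of_nonneg_left (setIntegral_mono_set
          (integrable_mul_expWeight hg hgi).integrableOn ?_ ?_) hS0
        · exact Eventually.of_forall fun t => mul_nonneg (hg t) (expWeight_pos t).le
        · exact (show Ioc 0 z ⊆ Iic z from fun t ht => ht.2).eventuallyLE
      _ ≤ S * (expWeight g z / 2) :=
        mul_le_mul_of_nonneg_left (integral_mul_expWeight_le hg hgi z) hS0
  have h2 : y z = S * expWeight g z := by
    rw [hS, div_mul_cancel₀ _ (expWeight_pos z).ne']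
  have hpos : 0 < expWeight g z := expWeight_pos z
  have hSz : S = 0 := by nlinarith
  have := hyS x hx
  rw [hSz, zero_mul] at this
  exact le_antisymm this (hy0 x hx)

variable {𝔸 : Type*} [NormedRing 𝔸]

theorem integrable_mul_boundedContinuous {V : ℝ → 𝔸} (hV : Integrable V) (m : ℝ →ᵇ 𝔸) :
    Integrable fun t => V t * m t := by
  refine Integrable.mono' (hV.norm.mul_const ‖m‖)
    (hV.aestronglyMeasurable.mul m.continuous.aestronglyMeasurable) ?_
  exact Eventually.of_forall fun t => (norm_mul_le _ _).trans
    (mul_le_mul_of_nonneg_left (m.norm_coe_le_norm t) (norm_nonneg _))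

variable [NormedAlgebra ℝ 𝔸]

/-- Dominated convergence with bound C‖q‖; it keeps the Volterra operator inside the bounded
continuous functions. -/
theorem continuous_integral_kernel {h : ℝ → ℝ} (hc : Continuous h) {C : ℝ}
    (hC : ∀ s, |h s| ≤ C) {q : ℝ → 𝔸} (hq : Integrable q) :
    Continuous fun x => ∫ t, h (x - t) • q t := by
  refine continuous_of_dominated (bound := fun t => C * ‖q t‖) (fun x => ?_) (fun x => ?_)
    (hq.norm.const_mul C) ?_
  · exact (by fun_prop : Continuous fun t => h (x - t)).aestronglyMeasurable.smul
      hq.aestronglyMeasurable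
  · refine Eventually.of_forall fun t => ?_
    rw [norm_smul]
    exact mul_le_mul_of_nonneg_right (hC _) (norm_nonneg _)
  · exact Eventually.of_forall fun t => by fun_prop

theorem integrable_kernel {h : ℝ → ℝ} (hc : Continuous h) {C : ℝ}
    (hC : ∀ s, |h s| ≤ C) {q : ℝ → 𝔸} (hq : Integrable q) (x : ℝ) :
    Integrable fun t => h (x - t) • q t := by
  refine Integrable.mono' (hq.norm.const_mul C)
    ((by fun_prop : Continuous fun t => h (x - t)).aestronglyMeasurable.smul
      hq.aestronglyMeasurable) (Eventually.of_forall fun t => ?_)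
  rw [norm_smul]
  exact mul_le_mul_of_nonneg_right (hC _) (norm_nonneg _)

/-- Solvability of a Volterra equation of the second kind with an integrable coefficient. -/
theorem exists_volterra_solution [CompleteSpace 𝔸] {V : ℝ → 𝔸} (hV : Integrable V) {h : ℝ → ℝ}
    (hc : Continuous h) (h0 : ∀ s ≤ 0, h s = 0) {C : ℝ} (hC : ∀ s, |h s| ≤ C) (m₀ : ℝ →ᵇ 𝔸) :
    ∃ m : ℝ →ᵇ 𝔸, ∀ x, m x = m₀ x + ∫ t, h (x - t) • (V t * m t) := by
  have hC0 : 0 ≤ C := (abs_nonneg _).trans (hC 0)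
  set g : ℝ → ℝ := fun t => C * ‖V t‖ with hgdef
  have hg : 0 ≤ g := fun t => mul_nonneg hC0 (norm_nonneg _)
  have hgi : Integrable g := hV.norm.const_mul C
  set w := expWeight g with hw
  have hwc : Continuous w := continuous_expWeight hgi
  have hwpos : ∀ x, 0 < w x := fun x => expWeight_pos x
  set W := Real.exp (2 * ∫ t, g t)
  -- The unknown is written m = w p, and the contraction acts on p in the sup norm. As 1 ≤ w ≤ W,
  -- this loses no boundedness in either direction.
  let mul_w : (ℝ →ᵇ 𝔸) → (ℝ →ᵇ 𝔸) := fun p =>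
    BoundedContinuousFunction.ofNormedAddCommGroup (fun x => w x • p x)
      (hwc.smul p.continuous) (W * ‖p‖) fun x => by
        rw [norm_smul, Real.norm_of_nonneg (hwpos x).le]
        exact mul_le_mul (expWeight_le hg hgi x) (p.norm_coe_le_norm x) (norm_nonneg _)
          (Real.exp_pos _).le
  have hbound : ∀ p : ℝ →ᵇ 𝔸, ∀ x,
      ‖(w x)⁻¹ • ∫ t, h (x - t) • (V t * (mul_w p) t)‖ ≤ 1 / 2 * ‖p‖ := by
    intro p x
    have h1 : ‖∫ t, h (x - t) • (V t * (mul_w p) t)‖ ≤ ∫ t in Iic x, g t * w t * ‖p‖ := by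
      rw [← integral_indicator measurableSet_Iic]
      refine norm_integral_le_of_norm_le (((integrable_mul_expWeight hg hgi).mul_const _).indicator
        measurableSet_Iic) (Eventually.of_forall fun t => ?_)
      by_cases htx : t ≤ x
      · rw [indicator_of_mem (show t ∈ Iic x from htx), norm_smul]
        calc ‖h (x - t)‖ * ‖V t * (w t • p t)‖ ≤ C * (‖V t‖ * (w t * ‖p‖)) := by
              refine mul_le_mul (hC _) ((norm_mul_le _ _).trans ?_) (norm_nonneg _) hC0
              rw [norm_smul, Real.norm_of_nonneg (hwpos t).le]
              have := hwpos t
              gcongr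
              exact p.norm_coe_le_norm t
          _ = g t * w t * ‖p‖ := by simp only [hgdef]; ring
      · rw [indicator_of_notMem (show t ∉ Iic x from htx), h0 _ (by linarith)]
        simp
    rw [integral_mul_const] at h1
    have h2 := integral_mul_expWeight_le hg hgi x
    rw [norm_smul, norm_inv, Real.norm_of_nonneg (hwpos x).le, inv_mul_le_iff₀ (hwpos x)]
    calc _ ≤ _ := h1
      _ ≤ w x / 2 * ‖p‖ := by gcongr
      _ = _ := by ring
  have hwinv : ∀ x, (w x)⁻¹ ≤ 1 := fun x => inv_le_one_of_one_le₀ (one_le_expWeight hg x)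
  let T : (ℝ →ᵇ 𝔸) → (ℝ →ᵇ 𝔸) := fun p =>
    BoundedContinuousFunction.ofNormedAddCommGroup
      (fun x => (w x)⁻¹ • (m₀ x + ∫ t, h (x - t) • (V t * (mul_w p) t)))
      ((hwc.inv₀ fun x => (hwpos x).ne').smul (m₀.continuous.add
        (continuous_integral_kernel hc hC (integrable_mul_boundedContinuous hV _))))
      (‖m₀‖ + 1 / 2 * ‖p‖) fun x => by
        rw [smul_add]
        refine (norm_add_le _ _).trans (add_le_add ?_ (hbound p x))
        rw [norm_smul, norm_inv, Real.norm_of_nonneg (hwpos x).le]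
        exact (mul_le_of_le_one_left (norm_nonneg _) (hwinv x)).trans (m₀.norm_coe_le_norm x)
  have hT : ContractingWith (1 / 2) T := by
    refine ⟨by rw [← NNReal.coe_lt_coe]; norm_num, LipschitzWith.of_dist_le_mul fun p q => ?_⟩
    refine (BoundedContinuousFunction.dist_le (by positivity)).2 fun x => ?_
    have : T p x - T q x = (w x)⁻¹ • ∫ t, h (x - t) • (V t * (mul_w (p - q)) t) := by
      have e : ∀ t, h (x - t) • (V t * (mul_w (p - q)) t) =
          h (x - t) • (V t * (mul_w p) t) - h (x - t) • (V t * (mul_w q) t) := fun t => by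
        change h (x - t) • (V t * (w t • (p t - q t))) =
          h (x - t) • (V t * (w t • p t)) - h (x - t) • (V t * (w t • q t))
        rw [smul_sub, mul_sub, smul_sub]
      simp_rw [e]
      rw [integral_sub (integrable_kernel hc hC (integrable_mul_boundedContinuous hV _) x)
        (integrable_kernel hc hC (integrable_mul_boundedContinuous hV _) x), smul_sub]
      change (w x)⁻¹ • (m₀ x + _) - (w x)⁻¹ • (m₀ x + _) = _
      rw [smul_add, smul_add, add_sub_add_left_eq_sub]
    rw [dist_eq_norm, this, dist_eq_norm]
    simpa using hbound (p - q) x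
  set p := hT.fixedPoint T
  have hp : T p = p := hT.fixedPoint_isFixedPt
  refine ⟨mul_w p, fun x => ?_⟩
  have : p x = (w x)⁻¹ • (m₀ x + ∫ t, h (x - t) • (V t * (mul_w p) t)) :=
    (DFunLike.congr_fun hp x).symm
  change w x • p x = _
  rw [this, smul_smul, mul_inv_cancel₀ (hwpos x).ne', one_smul]

end Volterra

/-! ### The equation in integral form: uniqueness and variation of constants -/

section Solutions

open MeasureTheory Set Filter Topology

variable {n : ℕ} {V : ℝ → Matrix (Fin n) (Fin n) ℂ} {k : ℂ}

theorem integrableOn_potential_mul (hV : IntegrableOn V (Ioi 0))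
    {u : ℝ → Matrix (Fin n) (Fin n) ℂ} (hu : ContinuousOn u (Ici 0)) (x : ℝ) :
    IntegrableOn (fun t => V t * u t) (Ioc 0 x) := by
  have hsub : Icc 0 x ⊆ Ici (0:ℝ) := fun t ht => ht.1
  obtain ⟨C, hC⟩ := isCompact_Icc.exists_bound_of_continuousOn (hu.mono hsub)
  have hV' : IntegrableOn V (Ioc 0 x) := hV.mono_set fun t ht => ht.1
  have mu : AEStronglyMeasurable u (volume.restrict (Ioc 0 x)) :=
    (hu.mono (Ioc_subset_Icc_self.trans hsub)).aestronglyMeasurable measurableSet_Ioc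
  refine Integrable.mono' (hV'.norm.mul_const C) (hV'.aestronglyMeasurable.mul mu) ?_
  filter_upwards [ae_restrict_mem measurableSet_Ioc] with t ht
  exact (norm_mul_le _ _).trans
    (mul_le_mul_of_nonneg_left (hC t (Ioc_subset_Icc_self ht)) (norm_nonneg _))

theorem MatrixSchrodinger.IsSolution.isPrimitive_deriv (hV : IntegrableOn V (Ioi 0))
    {ψ : ℝ → Matrix (Fin n) (Fin n) ℂ} (h : IsSolution V k ψ) :
    IsPrimitive (halfLineDeriv ψ) (fun t => V t * ψ t - k ^ 2 • ψ t) where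
  intervalIntegrable x hx := by
    rw [intervalIntegrable_iff_integrableOn_Ioc_of_le hx]
    have hc := h.differentiableOn.continuousOn
    refine (integrableOn_potential_mul hV hc x).sub ?_
    have : ContinuousOn (fun t => k ^ 2 • ψ t) (Icc 0 x) :=
      (hc.mono Icc_subset_Ici_self).fun_const_smul _
    exact this.integrableOn_Icc.mono_set Ioc_subset_Icc_self
  eq x hx := h.deriv_eq x hx

/-- The derivative is itself an indefinite integral, hence continuous, so the classical fundamental
theorem applies to ψ. -/
theorem MatrixSchrodinger.IsSolution.isPrimitive (hV : IntegrableOn V (Ioi 0))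
    {ψ : ℝ → Matrix (Fin n) (Fin n) ℂ} (h : IsSolution V k ψ) :
    IsPrimitive ψ (halfLineDeriv ψ) := by
  have hc := (h.isPrimitive_deriv hV).continuousOn
  have hint : ∀ x : ℝ, 0 ≤ x → IntervalIntegrable (halfLineDeriv ψ) volume 0 x := fun x hx =>
    ContinuousOn.intervalIntegrable (hc.mono fun t ht => by
      rw [uIcc_of_le hx] at ht; exact ht.1)
  refine ⟨hint, fun x hx => ?_⟩
  rw [intervalIntegral.integral_eq_sub_of_hasDerivAt_of_le hx
    (h.differentiableOn.continuousOn.mono fun t ht => ht.1) (fun t ht => ?_) (hint x hx)]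
  · abel
  · exact (h.differentiableOn t ht.1.le).hasDerivWithinAt.hasDerivAt (Ici_mem_nhds ht.1)

theorem IsPrimitive.isSolution {ψ χ : ℝ → Matrix (Fin n) (Fin n) ℂ} (h : IsPrimitive ψ χ)
    (h' : IsPrimitive χ (fun t => V t * ψ t - k ^ 2 • ψ t)) :
    IsSolution V k ψ ∧ ∀ x, 0 ≤ x → halfLineDeriv ψ x = χ x := by
  have hd : ∀ x : ℝ, 0 ≤ x → HasDerivWithinAt ψ (χ x) (Ici 0) x := fun x hx =>
    h.hasDerivWithinAt h'.continuousOn hx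
  have he : ∀ x, 0 ≤ x → halfLineDeriv ψ x = χ x := fun x hx =>
    (hd x hx).derivWithin (uniqueDiffOn_Ici 0 x hx)
  refine ⟨⟨fun x hx => (hd x hx).differentiableWithinAt, fun x hx => ?_⟩, he⟩
  rw [he x hx, he 0 le_rfl, h'.eq x hx]

/-- Uniqueness for the initial value problem. -/
theorem eq_zero_of_initial_eq_zero (hV : IntegrableOn V (Ioi 0))
    {u v : ℝ → Matrix (Fin n) (Fin n) ℂ} (hu : IsPrimitive u v)
    (hv : IsPrimitive v (fun t => V t * u t - k ^ 2 • u t)) (hu0 : u 0 = 0) (hv0 : v 0 = 0)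
    {X : ℝ} (hX : 0 ≤ X) : u X = 0 := by
  have hsub : Icc 0 X ⊆ Ici (0:ℝ) := fun t ht => ht.1
  have huc := hu.continuousOn.mono hsub
  have hvc := hv.continuousOn.mono hsub
  -- Gronwall is applied to ‖u‖ + ‖v‖ for the first-order system u' = v, v' = Vu - k²u, with
  -- coefficient 1 + ‖V‖ + ‖k²‖.
  have hyc : ContinuousOn (fun t => ‖u t‖ + ‖v t‖) (Icc 0 X) := huc.norm.add hvc.norm
  have hVX : IntegrableOn V (Ioc 0 X) := hV.mono_set fun t ht => ht.1
  have hki : IntegrableOn (fun t => 1 + ‖V t‖ + ‖k ^ 2‖) (Ioc 0 X) :=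
    ((integrableOn_const measure_Ioc_lt_top.ne).add hVX.norm).add
      (integrableOn_const measure_Ioc_lt_top.ne)
  have hkyi : IntegrableOn (fun t => (1 + ‖V t‖ + ‖k ^ 2‖) * (‖u t‖ + ‖v t‖)) (Ioc 0 X) := by
    obtain ⟨C, hC⟩ := isCompact_Icc.exists_bound_of_continuousOn hyc
    refine Integrable.mono' (hki.norm.mul_const C) (hki.aestronglyMeasurable.mul
      ((hyc.mono Ioc_subset_Icc_self).aestronglyMeasurable measurableSet_Ioc)) ?_
    filter_upwards [ae_restrict_mem measurableSet_Ioc] with t ht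
    rw [norm_mul]
    exact mul_le_mul_of_nonneg_left (hC t (Ioc_subset_Icc_self ht)) (norm_nonneg _)
  have key := eq_zero_of_le_integral (k := fun t => 1 + ‖V t‖ + ‖k ^ 2‖)
    (y := fun t => ‖u t‖ + ‖v t‖) (X := X) (fun t => by positivity) hki hyc
    (fun t _ => by positivity) (fun x hx => ?_) X ⟨hX, le_rfl⟩
  · have := norm_nonneg (v X)
    have := norm_nonneg (u X)
    exact norm_eq_zero.1 (by linarith)
  · have hs : Ioc 0 x ⊆ Ioc 0 X := Ioc_subset_Ioc_right hx.2
    have hvi := (intervalIntegrable_iff_integrableOn_Ioc_of_le hx.1).1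
      (hu.intervalIntegrable x hx.1)
    have hwi := (intervalIntegrable_iff_integrableOn_Ioc_of_le hx.1).1
      (hv.intervalIntegrable x hx.1)
    have h1 : ‖u x‖ ≤ ∫ t in Ioc 0 x, ‖v t‖ := by
      rw [hu.eq x hx.1, hu0, zero_add, intervalIntegral.integral_of_le hx.1]
      exact norm_integral_le_integral_norm _
    have h2 : ‖v x‖ ≤ ∫ t in Ioc 0 x, ‖V t * u t - k ^ 2 • u t‖ := by
      rw [hv.eq x hx.1, hv0, zero_add, intervalIntegral.integral_of_le hx.1]
      exact norm_integral_le_integral_norm _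
    refine (add_le_add h1 h2).trans ?_
    rw [← integral_add hvi.norm hwi.norm]
    refine integral_mono (hvi.norm.add hwi.norm) (hkyi.mono_set hs) fun t => ?_
    have h3 : ‖V t * u t - k ^ 2 • u t‖ ≤ ‖V t‖ * ‖u t‖ + ‖k ^ 2‖ * ‖u t‖ :=
      (norm_sub_le _ _).trans (add_le_add (norm_mul_le _ _) (norm_smul_le _ _))
    have a1 := norm_nonneg (u t)
    have a2 := norm_nonneg (v t)
    have a3 := norm_nonneg (V t)
    have a4 := norm_nonneg (k ^ 2)
    have a5 := mul_nonneg a3 a2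
    have a6 := mul_nonneg a4 a2
    simp only
    linarith

theorem imaginary_sq_smul (κ : ℝ) (M : Matrix (Fin n) (Fin n) ℂ) :
    (Complex.I * κ) ^ 2 • M = -(κ ^ 2 • M) := by
  have : (Complex.I * κ) ^ 2 = ((-(κ ^ 2) : ℝ) : ℂ) := by
    rw [mul_pow, Complex.I_sq]; push_cast; ring
  rw [this, Complex.coe_smul, neg_smul]

/-- Variation of constants at `k = iκ`. -/
theorem isSolution_of_variation_of_constants {κ : ℝ} (hκ : κ ≠ 0)
    {a b ψ : ℝ → Matrix (Fin n) (Fin n) ℂ}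
    (ha : IsPrimitive a fun t => Real.exp (-(κ * t)) • (V t * ψ t))
    (hb : IsPrimitive b fun t => Real.exp (κ * t) • (V t * ψ t))
    (hψ : ∀ x, 0 ≤ x →
      (2 * κ)⁻¹ • (Real.exp (κ * x) • a x - Real.exp (-(κ * x)) • b x) = ψ x) :
    IsSolution V (Complex.I * κ) ψ ∧ ∀ x, 0 ≤ x → halfLineDeriv ψ x =
      (2⁻¹ : ℝ) • (Real.exp (κ * x) • a x + Real.exp (-(κ * x)) • b x) := by
  have e1 : IsPrimitive (fun x => Real.exp (κ * x)) fun x => κ * Real.exp (κ * x) :=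
    .of_hasDerivAt (fun x => by
      simpa [mul_comm] using ((hasDerivAt_id x).const_mul κ).exp) (by fun_prop)
  have e2 : IsPrimitive (fun x => Real.exp (-(κ * x))) fun x => -(κ * Real.exp (-(κ * x))) :=
    .of_hasDerivAt (fun x => by
      simpa [mul_comm] using ((hasDerivAt_id x).const_mul κ).neg.exp) (by fun_prop)
  have hee : ∀ x : ℝ, Real.exp (κ * x) * Real.exp (-(κ * x)) = 1 := fun x => by
    rw [← Real.exp_add]; simp
  have hee' : ∀ x : ℝ, Real.exp (-(κ * x)) * Real.exp (κ * x) = 1 := fun x => by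
    rw [← Real.exp_add]; simp
  have p1 := e1.smul ha
  have p2 := e2.smul hb
  -- The terms e^{κx}a' and e^{-κx}b' both equal Vψ: they cancel in ψ' and add up in ψ''.
  have hp : IsPrimitive ψ fun x =>
      (2⁻¹ : ℝ) • (Real.exp (κ * x) • a x + Real.exp (-(κ * x)) • b x) := by
    refine (((p1.sub p2).clm ((2 * κ)⁻¹ • ContinuousLinearMap.id ℝ _)).congr_left hψ).congr
      fun x hx => ?_
    simp only [smul_apply, ContinuousLinearMap.id_apply, smul_smul, hee, hee', one_smul]
    match_scalars <;> (field_simp; try ring)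
  refine hp.isSolution ?_
  refine ((p1.add p2).clm ((2⁻¹ : ℝ) • ContinuousLinearMap.id ℝ _)).congr fun x hx => ?_
  rw [imaginary_sq_smul]
  simp only [smul_apply, ContinuousLinearMap.id_apply, smul_smul, hee, hee', one_smul]
  generalize V x * ψ x = W
  rw [← hψ x hx.le]
  match_scalars <;> (field_simp; try ring)

end Solutions

/-! ### Existence of the regular and Jost solutions on the positive imaginary axis -/

section Existence

open MeasureTheory Set Filter Topology BoundedContinuousFunction

variable {n : ℕ} {V : ℝ → Matrix (Fin n) (Fin n) ℂ}

/-- The Volterra kernel `(1 - e^{-2κs}) / (2κ)`, extended by zero to `s ≤ 0`. -/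
noncomputable def volterraKernel (κ s : ℝ) : ℝ := (2 * κ)⁻¹ * (1 - Real.exp (-(2 * κ * max s 0)))

theorem continuous_volterraKernel (κ : ℝ) : Continuous (volterraKernel κ) := by
  unfold volterraKernel; fun_prop

theorem volterraKernel_of_nonpos (κ : ℝ) {s : ℝ} (hs : s ≤ 0) : volterraKernel κ s = 0 := by
  simp [volterraKernel, hs]

theorem volterraKernel_of_nonneg (κ : ℝ) {s : ℝ} (hs : 0 ≤ s) :
    volterraKernel κ s = (2 * κ)⁻¹ * (1 - Real.exp (-(2 * κ * s))) := by
  simp [volterraKernel, hs]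

theorem abs_volterraKernel_le {κ : ℝ} (hκ : 0 < κ) (s : ℝ) : |volterraKernel κ s| ≤ (2 * κ)⁻¹ := by
  have h1 : Real.exp (-(2 * κ * max s 0)) ≤ 1 := Real.exp_le_one_iff.2 (by
    have := le_max_right s 0
    have : 0 ≤ 2 * κ * max s 0 := by positivity
    linarith)
  have h2 := Real.exp_pos (-(2 * κ * max s 0))
  rw [volterraKernel, abs_mul, abs_of_pos (by positivity : 0 < (2 * κ)⁻¹)]
  exact mul_le_of_le_one_right (by positivity) (abs_le.2 ⟨by linarith, by linarith⟩)

theorem isPrimitive_integral {E : Type*} [NormedAddCommGroup E] [NormedSpace ℝ E] {q : ℝ → E}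
    (hq : ∀ x : ℝ, 0 ≤ x → IntegrableOn q (Ioc 0 x)) (c : E) :
    IsPrimitive (fun x => c + ∫ t in (0 : ℝ)..x, q t) q where
  intervalIntegrable x hx := (intervalIntegrable_iff_integrableOn_Ioc_of_le hx).2 (hq x hx)
  eq x hx := by simp

theorem isPrimitive_tail_integral {E : Type*} [NormedAddCommGroup E] [NormedSpace ℝ E] {q : ℝ → E}
    (hq : IntegrableOn q (Ioi 0)) (c : E) :
    IsPrimitive (fun x => c - ∫ t in Ioi x, q t) q where
  intervalIntegrable x hx := (intervalIntegrable_iff_integrableOn_Ioc_of_le hx).2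
    (hq.mono_set fun t ht => ht.1)
  eq x hx := by
    have h := setIntegral_union (Ioc_disjoint_Ioi_same (a := (0:ℝ)) (b := x)) measurableSet_Ioi
      (hq.mono_set fun t ht => ht.1) (hq.mono_set fun t (ht : x < t) => hx.trans_lt ht)
    rw [Ioc_union_Ioi_eq_Ioi hx] at h
    rw [intervalIntegral.integral_of_le hx, h]
    abel

/-- The growth is factored out: m = e^{-κx}φ solves a Volterra equation whose kernel (1 -
e^{-2κs})/(2κ) is bounded. V is extended by zero to the left. -/
theorem exists_isRegularSolution (hV : IntegrableOn V (Ioi 0)) {κ : ℝ} (hκ : 0 < κ)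
    (A B : Matrix (Fin n) (Fin n) ℂ) : ∃ φ, IsRegularSolution V A B (Complex.I * κ) φ := by
  have hVi : Integrable ((Ioi 0).indicator V) := (integrable_indicator_iff measurableSet_Ioi).2 hV
  have hexp : ∀ x : ℝ, Real.exp (-(2 * κ * max x 0)) ≤ 1 := fun x => Real.exp_le_one_iff.2 (by
    have : 0 ≤ 2 * κ * max x 0 := by positivity
    linarith)
  obtain ⟨m, hm⟩ := exists_volterra_solution hVi (continuous_volterraKernel κ)
    (fun s hs => volterraKernel_of_nonpos κ hs) (abs_volterraKernel_le hκ)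
    -- For x ≥ 0 the free term is e^{-κx}(cosh(κx) A + κ⁻¹ sinh(κx) B); `max x 0` keeps it bounded
    -- on ℝ.
    (BoundedContinuousFunction.ofNormedAddCommGroup
      (fun x => (2 * κ)⁻¹ • ((B + κ • A) - Real.exp (-(2 * κ * max x 0)) • (B - κ • A)))
      (by fun_prop) ((2 * κ)⁻¹ * (‖B + κ • A‖ + ‖B - κ • A‖)) fun x => by
        rw [norm_smul, Real.norm_of_nonneg (by positivity)]
        gcongr
        refine (norm_sub_le _ _).trans (add_le_add_right ?_ _)
        rw [norm_smul, Real.norm_of_nonneg (Real.exp_pos _).le]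
        exact mul_le_of_le_one_left (norm_nonneg _) (hexp x))
  have hq := integrable_mul_boundedContinuous hVi m
  set q : ℝ → Matrix (Fin n) (Fin n) ℂ := fun t => (Ioi 0).indicator V t * m t with hqdef
  have hq2 : ∀ x : ℝ, IntegrableOn (fun t => Real.exp (2 * κ * t) • q t) (Ioc 0 x) := fun x => by
    rw [← integrableOn_Icc_iff_integrableOn_Ioc]
    exact hq.integrableOn.continuousOn_smul (by fun_prop) isCompact_Icc
  let ψ : ℝ → Matrix (Fin n) (Fin n) ℂ := fun x => Real.exp (κ * x) • m x
  have hqV : ∀ t, 0 < t → q t = Real.exp (-(κ * t)) • (V t * ψ t) := fun t ht => by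
    simp only [hqdef, ψ, indicator_of_mem (show t ∈ Ioi (0:ℝ) from ht), mul_smul_comm, smul_smul]
    rw [← Real.exp_add]
    simp
  -- The values a(0) = B + κA and b(0) = B - κA are those for which (a - b)/(2κ) and (a + b)/2 start
  -- at A and B.
  have ha := (isPrimitive_integral (fun x _ => hq.integrableOn (s := Ioc 0 x)) (B + κ • A)).congr hqV
  have hb := (isPrimitive_integral (fun x _ => hq2 x) (B - κ • A)).congr (b := fun t =>
    Real.exp (κ * t) • (V t * ψ t)) fun t ht => by
      rw [hqV t ht, smul_smul, ← Real.exp_add]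
      ring_nf
  have hψ : ∀ x, 0 ≤ x → (2 * κ)⁻¹ • (Real.exp (κ * x) • (B + κ • A + ∫ t in (0:ℝ)..x, q t) -
      Real.exp (-(κ * x)) • (B - κ • A + ∫ t in (0:ℝ)..x, Real.exp (2 * κ * t) • q t)) = ψ x := by
    intro x hx
    have h1 : ∫ t, volterraKernel κ (x - t) • q t = (2 * κ)⁻¹ • ((∫ t in (0:ℝ)..x, q t) -
        Real.exp (-(2 * κ * x)) • ∫ t in (0:ℝ)..x, Real.exp (2 * κ * t) • q t) := by
      have hq2s : ∀ x, IntegrableOn (fun t => Real.exp (-(2 * κ * x)) • Real.exp (2 * κ * t) • q t)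
          (Ioc 0 x) := fun x => Integrable.smul (Real.exp (-(2 * κ * x))) (hq2 x)
      rw [intervalIntegral.integral_of_le hx, intervalIntegral.integral_of_le hx, ← integral_smul,
        ← integral_sub hq.integrableOn (hq2s x), ← integral_smul,
        ← integral_indicator measurableSet_Ioc]
      congr 1
      ext1 t
      by_cases ht : t ∈ Ioc 0 x
      · rw [indicator_of_mem ht, volterraKernel_of_nonneg κ (sub_nonneg.2 ht.2), smul_smul,
          ← Real.exp_add, mul_smul, sub_smul, one_smul]
        ring_nf
      · rw [indicator_of_notMem ht]
        by_cases ht0 : 0 < t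
        · rw [volterraKernel_of_nonpos κ (sub_nonpos.2 (not_lt.1 fun h => ht ⟨ht0, h.le⟩)),
            zero_smul]
        · rw [hqdef]
          simp [ht0]
    have h2 : m x = (2 * κ)⁻¹ • ((B + κ • A) - Real.exp (-(2 * κ * x)) • (B - κ • A)) +
        ∫ t, volterraKernel κ (x - t) • q t := by
      have := hm x
      simp only [BoundedContinuousFunction.coe_ofNormedAddCommGroup, max_eq_left hx] at this
      exact this
    have h3 : Real.exp (-(κ * x)) = Real.exp (κ * x) * Real.exp (-(2 * κ * x)) := by
      rw [← Real.exp_add]; ring_nf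
    simp only [ψ]
    rw [h2, h1, h3]
    module
  obtain ⟨h1, h2⟩ := isSolution_of_variation_of_constants hκ.ne' ha hb hψ
  refine ⟨ψ, h1, ?_, ?_⟩
  · rw [← hψ 0 le_rfl]
    simp only [mul_zero, neg_zero, Real.exp_zero, one_smul, intervalIntegral.integral_same,
      add_zero]
    match_scalars <;> field_simp <;> ring
  · rw [h2 0 le_rfl]
    simp only [mul_zero, neg_zero, Real.exp_zero, one_smul, intervalIntegral.integral_same,
      add_zero]
    match_scalars <;> field_simp <;> ring

/-- Here m = e^{κx}f satisfies an equation integrating from x to ∞. The reflection x ↦ -x turns it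
into the Volterra equation already solved, with free term 1. -/
theorem exists_isJostSolution (hV : IntegrableOn V (Ioi 0)) {κ : ℝ} (hκ : 0 < κ) :
    ∃ f, IsJostSolution V (Complex.I * κ) f := by
  have hVi : Integrable ((Ioi 0).indicator V) := (integrable_indicator_iff measurableSet_Ioi).2 hV
  obtain ⟨μ, hμ⟩ := exists_volterra_solution hVi.comp_neg (continuous_volterraKernel κ)
    (fun s hs => volterraKernel_of_nonpos κ hs) (abs_volterraKernel_le hκ) 1
  let m : ℝ →ᵇ Matrix (Fin n) (Fin n) ℂ := μ.compContinuous ⟨fun x => -x, continuous_neg⟩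
  have hmμ : ∀ x, m x = μ (-x) := fun x => rfl
  have hq := integrable_mul_boundedContinuous hVi m
  set q : ℝ → Matrix (Fin n) (Fin n) ℂ := fun t => (Ioi 0).indicator V t * m t with hqdef
  have hm : ∀ x, m x = 1 + ∫ t, volterraKernel κ (t - x) • q t := fun x => by
    rw [hmμ, hμ, ← integral_neg_eq_self]
    simp only [hqdef, hmμ, neg_neg, BoundedContinuousFunction.coe_one, Pi.one_apply]
    congr 2
    ext1 t
    ring_nf
  have hq2 : IntegrableOn (fun t => Real.exp (-(2 * κ * t)) • q t) (Ioi 0) := by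
    refine Integrable.mono' hq.norm.integrableOn ((by fun_prop : Continuous fun t : ℝ =>
      Real.exp (-(2 * κ * t))).aestronglyMeasurable.smul hq.aestronglyMeasurable.restrict) ?_
    filter_upwards [ae_restrict_mem measurableSet_Ioi] with t ht
    rw [norm_smul, Real.norm_of_nonneg (Real.exp_pos _).le]
    refine mul_le_of_le_one_left (norm_nonneg _) (Real.exp_le_one_iff.2 ?_)
    have : 0 < 2 * κ * t := mul_pos (by positivity) ht
    linarith
  let ψ : ℝ → Matrix (Fin n) (Fin n) ℂ := fun x => Real.exp (-(κ * x)) • m x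
  have hqV : ∀ t, 0 < t → q t = Real.exp (κ * t) • (V t * ψ t) := fun t ht => by
    simp only [hqdef, ψ, indicator_of_mem (show t ∈ Ioi (0:ℝ) from ht), mul_smul_comm, smul_smul]
    rw [← Real.exp_add]
    simp
  -- The constants are limits at infinity: b → -2κI and a → 0 make e^{-κx}I the free part of ψ.
  have hb := (isPrimitive_tail_integral hq.integrableOn
    (-((2 * κ) • (1 : Matrix (Fin n) (Fin n) ℂ)))).congr hqV
  have ha := (isPrimitive_tail_integral hq2 0).congr (b := fun t =>
    Real.exp (-(κ * t)) • (V t * ψ t)) fun t ht => by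
      rw [hqV t ht, smul_smul, ← Real.exp_add]
      ring_nf
  have hψ : ∀ x, 0 ≤ x → (2 * κ)⁻¹ • (Real.exp (κ * x) •
      (0 - ∫ t in Ioi x, Real.exp (-(2 * κ * t)) • q t) - Real.exp (-(κ * x)) •
      (-((2 * κ) • (1 : Matrix (Fin n) (Fin n) ℂ)) - ∫ t in Ioi x, q t)) = ψ x := by
    intro x hx
    have h1 : ∫ t, volterraKernel κ (t - x) • q t = (2 * κ)⁻¹ • ((∫ t in Ioi x, q t) -
        Real.exp (2 * κ * x) • ∫ t in Ioi x, Real.exp (-(2 * κ * t)) • q t) := by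
      have hq2' : IntegrableOn (fun t => Real.exp (-(2 * κ * t)) • q t) (Ioi x) :=
        hq2.mono_set fun t (ht : x < t) => hx.trans_lt ht
      have hq2s : IntegrableOn (fun t => Real.exp (2 * κ * x) • Real.exp (-(2 * κ * t)) • q t)
          (Ioi x) := Integrable.smul (Real.exp (2 * κ * x)) hq2'
      rw [← integral_smul, ← integral_sub hq.integrableOn hq2s, ← integral_smul,
        ← integral_indicator measurableSet_Ioi]
      congr 1
      ext1 t
      by_cases ht : t ∈ Ioi x
      · rw [indicator_of_mem ht, volterraKernel_of_nonneg κ (sub_nonneg.2 (le_of_lt ht)),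
          smul_smul, ← Real.exp_add, mul_smul, sub_smul, one_smul]
        ring_nf
      · rw [indicator_of_notMem ht, volterraKernel_of_nonpos κ (sub_nonpos.2 (not_lt.1 ht)),
          zero_smul]
    have h3 : Real.exp (κ * x) = Real.exp (-(κ * x)) * Real.exp (2 * κ * x) := by
      rw [← Real.exp_add]; ring_nf
    simp only [ψ]
    rw [hm x, h1, h3]
    match_scalars <;> field_simp
  refine ⟨ψ, (isSolution_of_variation_of_constants hκ.ne' ha hb hψ).1, ?_⟩
  have hψm : ∀ x : ℝ, Complex.exp (-(Complex.I * (Complex.I * κ) * x)) • ψ x = m x := fun x => by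
    have e : Complex.exp (-(Complex.I * (Complex.I * κ) * x)) = (Real.exp (κ * x) : ℝ) := by
      push_cast
      rw [← mul_assoc, Complex.I_mul_I]
      ring_nf
    rw [e, Complex.coe_smul, smul_smul, ← Real.exp_add]
    simp
  simp_rw [hψm, hm]
  -- For each fixed t the integrand vanishes as soon as x ≥ t, so dominated convergence gives m → 1.
  have hlim : Tendsto (fun x => ∫ t, volterraKernel κ (t - x) • q t) atTop (𝓝 (∫ _ : ℝ, 0)) := by
    refine tendsto_integral_filter_of_dominated_convergence (fun t => (2 * κ)⁻¹ * ‖q t‖)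
      (Eventually.of_forall fun x => ?_) (Eventually.of_forall fun x => Eventually.of_forall
        fun t => ?_) (hq.norm.const_mul _) (Eventually.of_forall fun t => ?_)
    · exact ((continuous_volterraKernel κ).comp (by fun_prop)).aestronglyMeasurable.smul
        hq.aestronglyMeasurable
    · rw [norm_smul]
      exact mul_le_mul_of_nonneg_right (abs_volterraKernel_le hκ _) (norm_nonneg _)
    · refine tendsto_const_nhds.congr' ?_
      filter_upwards [eventually_ge_atTop t] with x hx
      rw [volterraKernel_of_nonpos κ (sub_nonpos.2 hx), zero_smul]
  simpa using hlim.const_add 1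

end Existence

/-! ### Decay and Wronskian of the Jost solution; dependence on initial data -/

section Jost

open MeasureTheory Set Filter Topology

variable {n : ℕ} {V : ℝ → Matrix (Fin n) (Fin n) ℂ} {κ : ℝ} {f : ℝ → Matrix (Fin n) (Fin n) ℂ}

theorem MatrixSchrodinger.IsJostSolution.tendsto_exp_smul
    (hf : IsJostSolution V (Complex.I * κ) f) :
    Tendsto (fun x : ℝ => Real.exp (κ * x) • f x) atTop (𝓝 1) := by
  refine hf.asymptotics.congr fun x => ?_
  have e : Complex.exp (-(Complex.I * (Complex.I * κ) * x)) = (Real.exp (κ * x) : ℝ) := by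
    push_cast
    rw [← mul_assoc, Complex.I_mul_I]
    ring_nf
  rw [e, Complex.coe_smul]

/-- Multiply by e^{κx} and let x → ∞. This is the left cancellation of f used to turn identities
between solutions into identities between constant matrices. -/
theorem MatrixSchrodinger.IsJostSolution.eq_zero_of_mul_eq_zero
    (hf : IsJostSolution V (Complex.I * κ) f) {R : Matrix (Fin n) (Fin n) ℂ}
    (hR : ∀ x : ℝ, 0 ≤ x → f x * R = 0) : R = 0 := by
  have h := hf.tendsto_exp_smul.mul_const R
  rw [one_mul] at h
  refine tendsto_nhds_unique h (tendsto_const_nhds.congr' ?_)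
  filter_upwards [eventually_ge_atTop 0] with x hx
  rw [smul_mul_assoc, hR x hx, smul_zero]

theorem MatrixSchrodinger.IsJostSolution.exists_norm_le
    (hf : IsJostSolution V (Complex.I * κ) f) :
    ∃ C : ℝ, ∀ x : ℝ, 0 ≤ x → ‖f x‖ ≤ C * Real.exp (-(κ * x)) := by
  have hb := hf.tendsto_exp_smul.norm.eventually_le_const
    (lt_add_one ‖(1 : Matrix (Fin n) (Fin n) ℂ)‖)
  obtain ⟨X, hX⟩ := eventually_atTop.1 hb
  have hc : ContinuousOn (fun x : ℝ => Real.exp (κ * x) • f x) (Icc 0 X) :=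
    ((by fun_prop : Continuous fun x : ℝ => Real.exp (κ * x)).continuousOn).smul
      (hf.isSolution.differentiableOn.continuousOn.mono Icc_subset_Ici_self)
  obtain ⟨C, hC⟩ := isCompact_Icc.exists_bound_of_continuousOn hc
  refine ⟨max C (‖(1 : Matrix (Fin n) (Fin n) ℂ)‖ + 1), fun x hx => ?_⟩
  have h1 : ‖Real.exp (κ * x) • f x‖ ≤ max C (‖(1 : Matrix (Fin n) (Fin n) ℂ)‖ + 1) := by
    rcases le_total x X with h | h
    · exact (hC x ⟨hx, h⟩).trans (le_max_left _ _)
    · exact (hX x h).trans (le_max_right _ _)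
  rw [norm_smul, Real.norm_of_nonneg (Real.exp_pos _).le] at h1
  rw [Real.exp_neg, ← div_eq_mul_inv, le_div_iff₀ (Real.exp_pos _), mul_comm]
  exact h1

theorem integrableOn_exp_neg (hκ : 0 < κ) :
    IntegrableOn (fun x : ℝ => Real.exp (-(κ * x))) (Ioi 0) := by
  simpa only [neg_mul] using exp_neg_integrableOn_Ioi 0 hκ

theorem MatrixSchrodinger.IsJostSolution.integrableOn_conjTranspose_mul
    (hκ : 0 < κ) (hf : IsJostSolution V (Complex.I * κ) f) :
    IntegrableOn (fun x => (f x)ᴴ * f x) (Ioi 0) := by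
  obtain ⟨C, hC⟩ := hf.exists_norm_le
  have hm : AEStronglyMeasurable f (volume.restrict (Ioi 0)) :=
    (hf.isSolution.differentiableOn.continuousOn.mono Ioi_subset_Ici_self).aestronglyMeasurable
      measurableSet_Ioi
  refine Integrable.mono' ((integrableOn_exp_neg (κ := 2 * κ) (by positivity)).const_mul (C * C))
    ((continuous_star.comp_aestronglyMeasurable hm).mul hm) ?_
  filter_upwards [ae_restrict_mem measurableSet_Ioi] with x hx
  have h := hC x (le_of_lt hx)
  have e : Real.exp (-(2 * κ * x)) = Real.exp (-(κ * x)) * Real.exp (-(κ * x)) := by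
    rw [← Real.exp_add]; ring_nf
  calc ‖(f x)ᴴ * f x‖ ≤ ‖(f x)ᴴ‖ * ‖f x‖ := norm_mul_le _ _
    _ = ‖f x‖ * ‖f x‖ := by rw [← Matrix.star_eq_conjTranspose, norm_star]
    _ ≤ (C * Real.exp (-(κ * x))) * (C * Real.exp (-(κ * x))) :=
      mul_le_mul h h (norm_nonneg _) ((norm_nonneg _).trans h)
    _ = C * C * Real.exp (-(2 * κ * x)) := by rw [e]; ring

/-- Vf and k²f are integrable because f decays. A mere bound on f' suffices: in the Wronskian f' is
always paired with f. -/
theorem MatrixSchrodinger.IsJostSolution.exists_norm_deriv_le (hV : IntegrableOn V (Ioi 0))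
    (hκ : 0 < κ) (hf : IsJostSolution V (Complex.I * κ) f) :
    ∃ C : ℝ, ∀ x : ℝ, 0 ≤ x → ‖halfLineDeriv f x‖ ≤ C := by
  obtain ⟨C, hC⟩ := hf.exists_norm_le
  have hC0 : 0 ≤ C := by
    have := (norm_nonneg _).trans (hC 0 le_rfl)
    simpa using this
  set k : ℂ := Complex.I * κ
  have hint : IntegrableOn (fun t => C * ‖V t‖ + ‖k ^ 2‖ * C * Real.exp (-(κ * t))) (Ioi 0) :=
    (hV.norm.const_mul C).add ((integrableOn_exp_neg hκ).const_mul _)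
  refine ⟨‖halfLineDeriv f 0‖ + ∫ t in Ioi 0, (C * ‖V t‖ + ‖k ^ 2‖ * C * Real.exp (-(κ * t))),
    fun x hx => ?_⟩
  rw [hf.isSolution.deriv_eq x hx, intervalIntegral.integral_of_le hx]
  refine (norm_add_le _ _).trans (add_le_add_right ?_ _)
  calc ‖∫ t in Ioc 0 x, (V t * f t - k ^ 2 • f t)‖
      ≤ ∫ t in Ioc 0 x, (C * ‖V t‖ + ‖k ^ 2‖ * C * Real.exp (-(κ * t))) := by
        refine norm_integral_le_of_norm_le (hint.mono_set Ioc_subset_Ioi_self) ?_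
        filter_upwards [ae_restrict_mem measurableSet_Ioc] with t ht
        have h := hC t ht.1.le
        have he : Real.exp (-(κ * t)) ≤ 1 :=
          Real.exp_le_one_iff.2 (neg_nonpos.2 (mul_nonneg hκ.le ht.1.le))
        calc ‖V t * f t - k ^ 2 • f t‖ ≤ ‖V t‖ * ‖f t‖ + ‖k ^ 2‖ * ‖f t‖ :=
              (norm_sub_le _ _).trans (add_le_add (norm_mul_le _ _) (norm_smul_le _ _))
          _ ≤ ‖V t‖ * C + ‖k ^ 2‖ * (C * Real.exp (-(κ * t))) := by
              gcongr
              exact h.trans (mul_le_of_le_one_right hC0 he)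
          _ = _ := by ring
    _ ≤ _ := by
        refine setIntegral_mono_set hint (Eventually.of_forall fun t => ?_)
          (Ioc_subset_Ioi_self).eventuallyLE
        have := Real.exp_pos (-(κ * t))
        simp only [Pi.zero_apply]
        positivity

theorem IsPrimitive.conjTranspose {u a : ℝ → Matrix (Fin n) (Fin n) ℂ} (h : IsPrimitive u a) :
    IsPrimitive (fun x => (u x)ᴴ) (fun x => (a x)ᴴ) :=
  h.clm (starL' ℝ : Matrix (Fin n) (Fin n) ℂ ≃L[ℝ] _).toContinuousLinearMap

/-- The Wronskian of a solution with itself is constant at a bound-state energy. -/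
theorem MatrixSchrodinger.IsSolution.wronskian_eq (hV : IntegrableOn V (Ioi 0))
    (hVh : ∀ x : ℝ, 0 < x → (V x).IsHermitian) (hf : IsSolution V (Complex.I * κ) f) {x : ℝ}
    (hx : 0 ≤ x) :
    (f x)ᴴ * halfLineDeriv f x - (halfLineDeriv f x)ᴴ * f x =
      (f 0)ᴴ * halfLineDeriv f 0 - (halfLineDeriv f 0)ᴴ * f 0 := by
  have p := hf.isPrimitive hV
  have p' := hf.isPrimitive_deriv hV
  have h := ((p.conjTranspose.mul p').sub (p'.conjTranspose.mul p)).congr (b := fun _ => 0)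
    fun t ht => by
      simp only [imaginary_sq_smul, Matrix.conjTranspose_sub, Matrix.conjTranspose_mul,
        (hVh t ht).eq, Matrix.conjTranspose_neg, Matrix.conjTranspose_smul, star_trivial]
      simp only [sub_neg_eq_add, mul_add, add_mul, mul_assoc, mul_smul_comm, smul_mul_assoc]
      abel
  simpa using h.eq x hx

/-- The Wronskian is constant, and it tends to 0 because f decays while f' stays bounded. -/
theorem MatrixSchrodinger.IsJostSolution.wronskian_eq_zero (hV : IntegrableOn V (Ioi 0))
    (hVh : ∀ x : ℝ, 0 < x → (V x).IsHermitian) (hκ : 0 < κ)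
    (hf : IsJostSolution V (Complex.I * κ) f) :
    (f 0)ᴴ * halfLineDeriv f 0 = (halfLineDeriv f 0)ᴴ * f 0 := by
  obtain ⟨C, hC⟩ := hf.exists_norm_le
  obtain ⟨C', hC'⟩ := hf.exists_norm_deriv_le hV hκ
  rw [← sub_eq_zero]
  have hlim : Tendsto (fun x : ℝ => 2 * C' * (C * Real.exp (-(κ * x)))) atTop (𝓝 0) := by
    have : Tendsto (fun x : ℝ => Real.exp (-(κ * x))) atTop (𝓝 0) :=
      Real.tendsto_exp_neg_atTop_nhds_zero.comp (tendsto_id.const_mul_atTop hκ)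
    simpa using (this.const_mul C).const_mul (2 * C')
  refine tendsto_nhds_unique (tendsto_const_nhds (f := atTop (α := ℝ)))
    (squeeze_zero_norm' ?_ hlim)
  filter_upwards [eventually_ge_atTop 0] with x hx
  rw [← hf.isSolution.wronskian_eq hV hVh hx]
  have h1 := hC x hx
  have h2 := hC' x hx
  have e1 : ‖(f x)ᴴ‖ = ‖f x‖ := norm_star _
  have e2 : ‖(halfLineDeriv f x)ᴴ‖ = ‖halfLineDeriv f x‖ := norm_star _
  calc _ ≤ ‖(f x)ᴴ‖ * ‖halfLineDeriv f x‖ + ‖(halfLineDeriv f x)ᴴ‖ * ‖f x‖ :=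
        (norm_sub_le _ _).trans (add_le_add (norm_mul_le _ _) (norm_mul_le _ _))
    _ = 2 * ‖halfLineDeriv f x‖ * ‖f x‖ := by rw [e1, e2]; ring
    _ ≤ _ := by
        have := (norm_nonneg _).trans h2
        gcongr

/-- Solutions that share their initial data up to right multiplication by constants agree. -/
theorem MatrixSchrodinger.IsSolution.mul_eq_mul (hV : IntegrableOn V (Ioi 0)) {k : ℂ}
    {g : ℝ → Matrix (Fin n) (Fin n) ℂ} (hf : IsSolution V k f) (hg : IsSolution V k g)
    {R S : Matrix (Fin n) (Fin n) ℂ} (h0 : f 0 * R = g 0 * S)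
    (h1 : halfLineDeriv f 0 * R = halfLineDeriv g 0 * S) {x : ℝ} (hx : 0 ≤ x) :
    f x * R = g x * S := by
  have mr : ∀ {u a : ℝ → Matrix (Fin n) (Fin n) ℂ} (T : Matrix (Fin n) (Fin n) ℂ),
      IsPrimitive u a → IsPrimitive (fun x => u x * T) (fun x => a x * T) := fun T h =>
    (h.mul (.const T)).congr fun x _ => by simp
  rw [← sub_eq_zero]
  refine eq_zero_of_initial_eq_zero hV (k := k) (u := fun x => f x * R - g x * S)
    (v := fun x => halfLineDeriv f x * R - halfLineDeriv g x * S)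
    ((mr R (hf.isPrimitive hV)).sub (mr S (hg.isPrimitive hV)))
    (((mr R (hf.isPrimitive_deriv hV)).sub (mr S (hg.isPrimitive_deriv hV))).congr fun t _ => ?_)
    (sub_eq_zero.2 h0) (sub_eq_zero.2 h1) hx
  simp only [sub_mul, mul_sub, mul_assoc, smul_sub, smul_mul_assoc]
  abel

end Jost

/-! ### Lagrangian subspaces, kernel projections and Gram matrices -/

section MatrixAlgebra

open MeasureTheory Set Filter Topology

variable {n : ℕ}

theorem eq_zero_of_conjTranspose_mul_self_add_eq_zero {X Y : Matrix (Fin n) (Fin n) ℂ}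
    (h : Xᴴ * X + Yᴴ * Y = 0) : X = 0 ∧ Y = 0 := by
  have h1 := (add_eq_zero_iff_of_nonneg (star_mul_self_nonneg X) (star_mul_self_nonneg Y)).1 h
  exact ⟨Matrix.conjTranspose_mul_self_eq_zero.1 h1.1,
    Matrix.conjTranspose_mul_self_eq_zero.1 h1.2⟩

/-- Left multiplication by G is an injective endomorphism of a finite-dimensional space, so it hits
1. Testing on matrices avoids passing to vectors. -/
theorem Matrix.isUnit_of_forall_mul_eq_zero {G : Matrix (Fin n) (Fin n) ℂ}
    (h : ∀ R : Matrix (Fin n) (Fin n) ℂ, G * R = 0 → R = 0) : IsUnit G := by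
  have hinj : Function.Injective (LinearMap.mulLeft ℂ G) :=
    (injective_iff_map_eq_zero _).2 h
  obtain ⟨X, hX⟩ := LinearMap.injective_iff_surjective.1 hinj 1
  exact IsUnit.of_mul_eq_one X hX

/-- Maximality of a Lagrangian subspace of `ℂ²ⁿ`: whatever is orthogonal to it belongs to it. -/
theorem exists_eq_mul_of_lagrangian {F₀ F₁ X Y : Matrix (Fin n) (Fin n) ℂ}
    (hF : F₀ᴴ * F₁ = F₁ᴴ * F₀)
    (hinj : ∀ R : Matrix (Fin n) (Fin n) ℂ, F₀ * R = 0 → F₁ * R = 0 → R = 0)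
    (hXY : F₀ᴴ * Y = F₁ᴴ * X) :
    ∃ R : Matrix (Fin n) (Fin n) ℂ, X = F₀ * R ∧ Y = F₁ * R := by
  set G := F₀ᴴ * F₀ + F₁ᴴ * F₁ with hG
  have hu : IsUnit G := Matrix.isUnit_of_forall_mul_eq_zero fun R hR => by
    have h : (F₀ * R)ᴴ * (F₀ * R) + (F₁ * R)ᴴ * (F₁ * R) = 0 := by
      calc _ = Rᴴ * (G * R) := by
            rw [hG]; simp only [Matrix.conjTranspose_mul, add_mul, mul_add, mul_assoc]
        _ = 0 := by rw [hR, mul_zero]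
    obtain ⟨h0, h1⟩ := eq_zero_of_conjTranspose_mul_self_add_eq_zero h
    exact hinj R h0 h1
  have hGd : IsUnit G.det := (Matrix.isUnit_iff_isUnit_det G).1 hu
  have hGG : G⁻¹ * G = 1 := Matrix.nonsing_inv_mul _ hGd
  -- the block matrix with columns `(F₀, F₁)` and `(-F₁, F₀)` has an explicit left inverse
  let U : Matrix (Fin n ⊕ Fin n) (Fin n ⊕ Fin n) ℂ := Matrix.fromBlocks F₀ (-F₁) F₁ F₀
  let W : Matrix (Fin n ⊕ Fin n) (Fin n ⊕ Fin n) ℂ :=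
    Matrix.fromBlocks (G⁻¹ * F₀ᴴ) (G⁻¹ * F₁ᴴ) (-(G⁻¹ * F₁ᴴ)) (G⁻¹ * F₀ᴴ)
  have hWU : W * U = 1 := by
    rw [Matrix.fromBlocks_multiply, ← Matrix.fromBlocks_one]
    congr 1
    · rw [mul_assoc, mul_assoc, ← mul_add, ← hG, hGG]
    · rw [mul_neg, mul_assoc, mul_assoc, hF, neg_add_cancel]
    · rw [neg_mul, mul_assoc, mul_assoc, hF, neg_add_cancel]
    · rw [neg_mul_neg, mul_assoc, mul_assoc, ← mul_add, add_comm, ← hG, hGG]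
  have hUW : U * W = 1 := mul_eq_one_comm.1 hWU
  rw [Matrix.fromBlocks_multiply, ← Matrix.fromBlocks_one, Matrix.fromBlocks_inj] at hUW
  obtain ⟨h11, h12, h21, h22⟩ := hUW
  -- These are the coefficients of the orthogonal projection of (X, Y) onto the columns of (F₀, F₁).
  -- The coefficient along (-F₁, F₀) is G⁻¹(F₀†Y - F₁†X), which vanishes by hypothesis.
  refine ⟨G⁻¹ * (F₀ᴴ * X + F₁ᴴ * Y), ?_, ?_⟩
  · calc X = (F₀ * (G⁻¹ * F₀ᴴ) + -F₁ * -(G⁻¹ * F₁ᴴ)) * X +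
          (F₀ * (G⁻¹ * F₁ᴴ) + -F₁ * (G⁻¹ * F₀ᴴ)) * Y := by
            rw [h11, h12, one_mul, zero_mul, add_zero]
      _ = F₀ * (G⁻¹ * (F₀ᴴ * X + F₁ᴴ * Y)) + F₁ * (G⁻¹ * (F₁ᴴ * X - F₀ᴴ * Y)) := by
            noncomm_ring
      _ = _ := by rw [hXY, sub_self, mul_zero, mul_zero, add_zero]
  · calc Y = (F₁ * (G⁻¹ * F₀ᴴ) + F₀ * -(G⁻¹ * F₁ᴴ)) * X +
          (F₁ * (G⁻¹ * F₁ᴴ) + F₀ * (G⁻¹ * F₀ᴴ)) * Y := by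
            rw [h21, h22, one_mul, zero_mul, zero_add]
      _ = F₁ * (G⁻¹ * (F₀ᴴ * X + F₁ᴴ * Y)) + F₀ * (G⁻¹ * (F₀ᴴ * Y - F₁ᴴ * X)) := by
            noncomm_ring
      _ = _ := by rw [hXY, sub_self, mul_zero, mul_zero, add_zero]

theorem toEuclideanLin_mul_apply (M X : Matrix (Fin n) (Fin n) ℂ) (v : EuclideanSpace ℂ (Fin n)) :
    Matrix.toEuclideanLin (M * X) v = Matrix.toEuclideanLin M (Matrix.toEuclideanLin X v) := by
  simp [Matrix.toLpLin_apply]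

theorem toEuclideanLin_projectionMatrix (K : Submodule ℂ (EuclideanSpace ℂ (Fin n)))
    (v : EuclideanSpace ℂ (Fin n)) :
    Matrix.toEuclideanLin (projectionMatrix K) v = K.starProjection v :=
  DFunLike.congr_fun ((Matrix.toEuclideanCLM (n := Fin n) (𝕜 := ℂ)).apply_symm_apply
    K.starProjection) v

theorem projectionMatrix_isStarProjection (K : Submodule ℂ (EuclideanSpace ℂ (Fin n))) :
    IsStarProjection (projectionMatrix K) := by
  have h := isStarProjection_starProjection (U := K)
  let e := (Matrix.toEuclideanCLM (n := Fin n) (𝕜 := ℂ)).symm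
  refine ⟨?_, ?_⟩
  · exact (e.map_mul' _ _).symm.trans (congrArg e h.isIdempotentElem)
  · exact (e.map_star' _).symm.trans (congrArg e h.isSelfAdjoint)

theorem mul_projectionMatrix_matrixKernel (M : Matrix (Fin n) (Fin n) ℂ) :
    M * projectionMatrix (matrixKernel M) = 0 := by
  refine Matrix.toEuclideanLin.injective (LinearMap.ext fun v => ?_)
  rw [toEuclideanLin_mul_apply, toEuclideanLin_projectionMatrix, map_zero]
  exact LinearMap.mem_ker.1 (Submodule.starProjection_apply_mem (matrixKernel M) v)

theorem projectionMatrix_matrixKernel_mul {M X : Matrix (Fin n) (Fin n) ℂ} (h : M * X = 0) :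
    projectionMatrix (matrixKernel M) * X = X := by
  refine Matrix.toEuclideanLin.injective (LinearMap.ext fun v => ?_)
  rw [toEuclideanLin_mul_apply, toEuclideanLin_projectionMatrix]
  refine Submodule.starProjection_eq_self_iff.2 (LinearMap.mem_ker.2 ?_)
  rw [← toEuclideanLin_mul_apply, h, map_zero, LinearMap.zero_apply]

theorem isProj_projectionMatrix (K : Submodule ℂ (EuclideanSpace ℂ (Fin n))) :
    LinearMap.IsProj K (Matrix.toEuclideanLin (projectionMatrix K)) :=
  ⟨fun v => toEuclideanLin_projectionMatrix K v ▸ Submodule.starProjection_apply_mem _ v,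
    fun v hv => (toEuclideanLin_projectionMatrix K v).trans
      (Submodule.starProjection_eq_self_iff.2 hv)⟩

theorem trace_projectionMatrix (K : Submodule ℂ (EuclideanSpace ℂ (Fin n))) :
    (projectionMatrix K).trace = Module.finrank ℂ K := by
  rw [← (isProj_projectionMatrix K).trace, Matrix.toEuclideanLin_eq_toLin_orthonormal,
    Matrix.trace_toLin_eq]

theorem rank_eq_finrank_range_toEuclideanLin (M : Matrix (Fin n) (Fin n) ℂ) :
    M.rank = Module.finrank ℂ (LinearMap.range (Matrix.toEuclideanLin M)) := by
  rw [Matrix.toEuclideanLin_eq_toLin_orthonormal]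
  exact Matrix.rank_eq_finrank_range_toLin _ _ _

theorem rank_projectionMatrix (K : Submodule ℂ (EuclideanSpace ℂ (Fin n))) :
    (projectionMatrix K).rank = Module.finrank ℂ K := by
  rw [rank_eq_finrank_range_toEuclideanLin, (isProj_projectionMatrix K).range]

/-- Rank-nullity, since M and M† have equal rank. Hence P and Q have the same trace. -/
theorem finrank_matrixKernel_conjTranspose (M : Matrix (Fin n) (Fin n) ℂ) :
    Module.finrank ℂ (matrixKernel Mᴴ) = Module.finrank ℂ (matrixKernel M) := by
  have h1 := LinearMap.finrank_range_add_finrank_ker (Matrix.toEuclideanLin M)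
  have h2 := LinearMap.finrank_range_add_finrank_ker (Matrix.toEuclideanLin Mᴴ)
  rw [← rank_eq_finrank_range_toEuclideanLin] at h1 h2
  rw [Matrix.rank_conjTranspose] at h2
  unfold matrixKernel
  omega

/-- A continuous matrix function with vanishing Gram integral on the half line vanishes. -/
theorem eq_zero_of_integral_conjTranspose_mul_self_eq_zero {g : ℝ → Matrix (Fin n) (Fin n) ℂ}
    (hg : ContinuousOn g (Ici 0)) (hi : IntegrableOn (fun x => (g x)ᴴ * g x) (Ioi 0))
    (h0 : ∫ x in Ioi 0, (g x)ᴴ * g x = 0) {x : ℝ} (hx : 0 ≤ x) : g x = 0 := by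
  -- The real part of the trace reduces the question to a nonnegative scalar integrand, zero a.e.
  -- and then everywhere on [0, ∞) by continuity.
  let L : Matrix (Fin n) (Fin n) ℂ →L[ℝ] ℝ := LinearMap.toContinuousLinearMap
    (Complex.reLm ∘ₗ (Matrix.traceLinearMap (Fin n) ℂ ℂ).restrictScalars ℝ)
  have hL : ∀ M, L M = (M.trace).re := fun M => rfl
  have hpos : ∀ M : Matrix (Fin n) (Fin n) ℂ, 0 ≤ (Mᴴ * M).trace := fun M =>
    (Matrix.posSemidef_conjTranspose_mul_self M).trace_nonneg
  have hnn : ∀ x, 0 ≤ L ((g x)ᴴ * g x) := fun x => (Complex.le_def.1 (hpos _)).1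
  have hint : ∫ x in Ioi 0, L ((g x)ᴴ * g x) = 0 := by
    rw [L.integral_comp_comm hi, h0, map_zero]
  have hae := (integral_eq_zero_iff_of_nonneg hnn (L.integrable_comp hi)).1 hint
  have hc : ContinuousOn (fun x => L ((g x)ᴴ * g x)) (Ici 0) :=
    L.continuous.comp_continuousOn ((continuous_star.comp_continuousOn hg).mul hg)
  have hIoi : EqOn (fun x => L ((g x)ᴴ * g x)) 0 (Ioi 0) :=
    Measure.eqOn_open_of_ae_eq hae isOpen_Ioi (hc.mono Ioi_subset_Ici_self) continuousOn_const
  have hIci : EqOn (fun x => L ((g x)ᴴ * g x)) 0 (Ici 0) :=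
    hIoi.of_subset_closure hc continuousOn_const Ioi_subset_Ici_self (by rw [closure_Ioi])
  have hz : L ((g x)ᴴ * g x) = 0 := hIci hx
  refine Matrix.trace_conjTranspose_mul_self_eq_zero_iff.1 (Complex.ext hz ?_)
  exact (Complex.le_def.1 (hpos (g x))).2.symm

variable {Q : Matrix (Fin n) (Fin n) ℂ}

/-- `I - Q + ∫ Q g† g Q` is nonnegative and invertible if `g Q` is injective. -/
theorem gram_nonneg_isUnit (hQ : IsStarProjection Q) {g : ℝ → Matrix (Fin n) (Fin n) ℂ}
    (hg : ContinuousOn g (Ici 0)) (hi : IntegrableOn (fun x => Q * (g x)ᴴ * g x * Q) (Ioi 0))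
    (hinj : ∀ R, (∀ x : ℝ, 0 ≤ x → g x * (Q * R) = 0) → Q * R = 0) :
    0 ≤ 1 - Q + ∫ x in Ioi 0, Q * (g x)ᴴ * g x * Q ∧
      IsUnit (1 - Q + ∫ x in Ioi 0, Q * (g x)ᴴ * g x * Q) := by
  have hQs : Qᴴ = Q := hQ.isSelfAdjoint
  have hQQ : Q * Q = Q := hQ.isIdempotentElem
  have e : ∀ x, Q * (g x)ᴴ * g x * Q = (g x * Q)ᴴ * (g x * Q) := fun x => by
    rw [Matrix.conjTranspose_mul, hQs]; simp only [mul_assoc]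
  have hQ1 : (1 - Q : Matrix (Fin n) (Fin n) ℂ) = (1 - Q)ᴴ * (1 - Q) := by
    rw [Matrix.conjTranspose_sub, hQs, Matrix.conjTranspose_one, sub_mul, mul_sub, mul_sub, hQQ]
    simp
  simp only [e] at hi ⊢
  have hS : 0 ≤ ∫ x in Ioi 0, (g x * Q)ᴴ * (g x * Q) :=
    integral_nonneg fun x => star_mul_self_nonneg (g x * Q)
  have h1Q : 0 ≤ 1 - Q := by rw [hQ1]; exact star_mul_self_nonneg _
  refine ⟨add_nonneg h1Q hS, Matrix.isUnit_of_forall_mul_eq_zero fun R hR => ?_⟩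
  set S := ∫ x in Ioi 0, (g x * Q)ᴴ * (g x * Q) with hSdef
  -- Both summands are nonnegative, so each vanishes: the first gives R = QR, the second g QR = 0 on
  -- the half line, hence QR = 0.
  have hzero : Rᴴ * (1 - Q) * R + Rᴴ * S * R = 0 := by
    rw [← add_mul, ← mul_add, mul_assoc, hR, mul_zero]
  obtain ⟨h1, h2⟩ := (add_eq_zero_iff_of_nonneg (star_left_conjugate_nonneg h1Q R)
    (star_left_conjugate_nonneg hS R)).1 hzero
  have h1' : R - Q * R = 0 := by
    have : ((1 - Q) * R)ᴴ * ((1 - Q) * R) = 0 := by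
      rw [Matrix.conjTranspose_mul, mul_assoc, ← mul_assoc _ (1 - Q), ← hQ1, ← mul_assoc]
      exact h1
    simpa [sub_mul] using Matrix.conjTranspose_mul_self_eq_zero.1 this
  have e2 : ∀ x, Rᴴ * ((g x * Q)ᴴ * (g x * Q)) * R = (g x * (Q * R))ᴴ * (g x * (Q * R)) :=
    fun x => by simp only [Matrix.conjTranspose_mul, mul_assoc]
  have hi2 : IntegrableOn (fun x => (g x * (Q * R))ᴴ * (g x * (Q * R))) (Ioi 0) := by
    simp only [← e2]
    exact (hi.const_mul _).mul_const _
  have h2' : ∫ x in Ioi 0, (g x * (Q * R))ᴴ * (g x * (Q * R)) = 0 := by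
    simp only [← e2]
    rw [integral_mul_const_of_integrable (hi.const_mul _), integral_const_mul_of_integrable hi]
    exact h2
  have hQR : Q * R = 0 := hinj R fun x hx =>
    eq_zero_of_integral_conjTranspose_mul_self_eq_zero (g := fun x => g x * (Q * R))
      (hg.mul continuousOn_const) hi2 h2' hx
  rwa [hQR, sub_zero] at h1'

/-- Properties of the normalization `H^{-1/2} Q` attached to `H = I - Q + Q S Q`. -/
theorem normalization_properties (hQ : IsStarProjection Q) {S H : Matrix (Fin n) (Fin n) ℂ}
    (hH : H = 1 - Q + S) (hQS : Q * S = S) (hSQ : S * Q = S) (h0 : 0 ≤ H) (hu : IsUnit H) :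
    IsUnit (CFC.sqrt H).det ∧ Q * CFC.sqrt H = CFC.sqrt H * Q ∧
      Q * ((CFC.sqrt H)⁻¹ * Q) = (CFC.sqrt H)⁻¹ * Q ∧
      ((CFC.sqrt H)⁻¹ * Q)ᴴ * S * ((CFC.sqrt H)⁻¹ * Q) = Q := by
  have hQs : Qᴴ = Q := hQ.isSelfAdjoint
  have hQQ : Q * Q = Q := hQ.isIdempotentElem
  set h := CFC.sqrt H with hh
  have hhH : h * h = H := CFC.sqrt_mul_sqrt_self H h0
  have hhs : hᴴ = h := (CFC.sqrt_nonneg H).isSelfAdjoint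
  have hhu : IsUnit h.det := (Matrix.isUnit_iff_isUnit_det h).1 ((CFC.isUnit_sqrt_iff H h0).2 hu)
  have hHQ : H * Q = S := by rw [hH, add_mul, sub_mul, hQQ, hSQ]; simp
  have hQH : Q * H = S := by rw [hH, mul_add, mul_sub, hQQ, hQS]; simp
  -- H commutes with Q because HQ = S = QH, and the functional calculus passes this on to the square
  -- root.
  have hcomm : Q * h = h * Q := by
    have : Commute H Q := hHQ.trans hQH.symm
    rw [hh, CFC.sqrt_eq_cfc]
    exact (this.cfc_nnreal NNReal.sqrt).eq.symm
  have hinv : Q * h⁻¹ = h⁻¹ * Q := by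
    calc Q * h⁻¹ = h⁻¹ * (h * Q) * h⁻¹ := by
          rw [← mul_assoc, Matrix.nonsing_inv_mul _ hhu, one_mul]
      _ = h⁻¹ * Q := by
          rw [← hcomm, mul_assoc, mul_assoc, Matrix.mul_nonsing_inv _ hhu, mul_one]
  refine ⟨hhu, hcomm, by rw [← mul_assoc, hinv, mul_assoc, hQQ], ?_⟩
  have hNs : (h⁻¹ * Q)ᴴ = Q * h⁻¹ := by
    rw [Matrix.conjTranspose_mul, Matrix.conjTranspose_nonsing_inv, hhs, hQs]
  calc (h⁻¹ * Q)ᴴ * S * (h⁻¹ * Q) = Q * (h⁻¹ * h) * (h * Q) * (h⁻¹ * Q) := by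
        rw [hNs, ← hHQ, ← hhH]; simp only [mul_assoc]
    _ = Q * (Q * (h * h⁻¹)) * Q := by
        rw [Matrix.nonsing_inv_mul _ hhu, ← hcomm]; simp only [mul_assoc, one_mul]
    _ = Q := by rw [Matrix.mul_nonsing_inv _ hhu, mul_one, hQQ, hQQ]

end MatrixAlgebra

/-! ### The regular solution against the Jost solution at a bound state -/

section DependencyMatrix

open MeasureTheory Set

variable {n : ℕ} {V : ℝ → Matrix (Fin n) (Fin n) ℂ} {A B : Matrix (Fin n) (Fin n) ℂ} {κ : ℝ}

theorem isJostSolution_jostSolution (hV : IntegrableOn V (Ioi 0)) (hκ : 0 < κ) :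
    IsJostSolution V (Complex.I * κ) (jostSolution V (Complex.I * κ)) :=
  Classical.epsilon_spec (exists_isJostSolution hV hκ)

theorem isRegularSolution_regularSolution (hV : IntegrableOn V (Ioi 0)) (hκ : 0 < κ)
    (A B : Matrix (Fin n) (Fin n) ℂ) :
    IsRegularSolution V A B (Complex.I * κ) (regularSolution V A B (Complex.I * κ)) :=
  Classical.epsilon_spec (exists_isRegularSolution hV hκ A B)

theorem jostMatrix_imaginary (V : ℝ → Matrix (Fin n) (Fin n) ℂ) (A B : Matrix (Fin n) (Fin n) ℂ)
    (κ : ℝ) : jostMatrix V A B (Complex.I * κ) =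
      (jostSolution V (Complex.I * κ) 0)ᴴ * B -
        (halfLineDeriv (jostSolution V (Complex.I * κ)) 0)ᴴ * A := by
  have : -(starRingEnd ℂ (Complex.I * κ)) = Complex.I * κ := by simp
  rw [jostMatrix, this]

/-- On `Ker J(iκ)` the regular solution is a combination of the columns of the Jost solution, with
coefficients in `Ker J(iκ)†`. -/
theorem exists_regularSolution_mul_projQ_eq (hV : IntegrableOn V (Ioi 0))
    (hVh : ∀ x : ℝ, 0 < x → (V x).IsHermitian) (hκ : 0 < κ) (hAB : Aᴴ * B = Bᴴ * A) :
    ∃ R : Matrix (Fin n) (Fin n) ℂ, projP V A B κ * R = R ∧ ∀ x : ℝ, 0 ≤ x →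
      regularSolution V A B (Complex.I * κ) x * projQ V A B κ =
        jostSolution V (Complex.I * κ) x * R := by
  have hf := isJostSolution_jostSolution hV hκ
  have hφ := isRegularSolution_regularSolution hV hκ A B
  have hJ := jostMatrix_imaginary V A B κ
  set f := jostSolution V (Complex.I * κ)
  set φ := regularSolution V A B (Complex.I * κ)
  have hJQ : jostMatrix V A B (Complex.I * κ) * projQ V A B κ = 0 :=
    mul_projectionMatrix_matrixKernel _
  set Q := projQ V A B κ
  -- In this form JQ = 0 reads f(0)†(BQ) = f'(0)†(AQ): the symplectic orthogonality required by the
  -- Lagrangian lemma.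
  rw [hJ, sub_mul, mul_assoc, mul_assoc, sub_eq_zero] at hJQ
  obtain ⟨R, hR0, hR1⟩ := exists_eq_mul_of_lagrangian (hf.wronskian_eq_zero hV hVh hκ)
    (fun R h0 h1 => hf.eq_zero_of_mul_eq_zero fun x hx => by
      rw [hf.isSolution.mul_eq_mul hV hf.isSolution (S := 0) (by rw [h0, mul_zero])
        (by rw [h1, mul_zero]) hx, mul_zero]) hJQ
  refine ⟨R, projectionMatrix_matrixKernel_mul ?_, fun x hx =>
    hφ.isSolution.mul_eq_mul hV hf.isSolution (by rw [hφ.initial_value, hR0])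
      (by rw [hφ.initial_deriv, hR1]) hx⟩
  rw [hJ]
  simp only [Matrix.conjTranspose_sub, Matrix.conjTranspose_mul, Matrix.conjTranspose_conjTranspose]
  -- J†R = B†f(0)R - A†f'(0)R = (B†A - A†B)Q, zero by the selfadjointness of the boundary condition.
  rw [sub_mul, mul_assoc, mul_assoc, ← hR0, ← hR1, ← mul_assoc, ← mul_assoc, hAB, sub_self]

/-- Evaluating φR and its derivative at 0 gives AR = BR = 0, and A†A + B†B is invertible. -/
theorem regularSolution_injective (hV : IntegrableOn V (Ioi 0)) (hκ : 0 < κ)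
    (hpos : (Aᴴ * A + Bᴴ * B).PosDef) {R : Matrix (Fin n) (Fin n) ℂ}
    (hR : ∀ x : ℝ, 0 ≤ x → regularSolution V A B (Complex.I * κ) x * R = 0) : R = 0 := by
  have hφ := isRegularSolution_regularSolution hV hκ A B
  set φ := regularSolution V A B (Complex.I * κ)
  have h0 : A * R = 0 := by rw [← hφ.initial_value]; exact hR 0 le_rfl
  have h1 : B * R = 0 := by
    have hd := (hφ.isSolution.differentiableOn 0 Set.self_mem_Ici).hasDerivWithinAt.mul_const R
    have hz : HasDerivWithinAt (fun x => φ x * R) 0 (Ici 0) 0 :=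
      (hasDerivWithinAt_const _ _ _).congr (fun x hx => hR x hx) (hR 0 le_rfl)
    have := (uniqueDiffOn_Ici (0:ℝ) 0 Set.self_mem_Ici).eq_deriv _ hd hz
    rw [← hφ.initial_deriv]
    exact this
  have hz : (Aᴴ * A + Bᴴ * B) * R = 0 := by
    rw [add_mul, mul_assoc, mul_assoc, h0, h1, mul_zero, mul_zero, add_zero]
  exact hpos.isUnit.mul_right_eq_zero.1 hz

theorem MatrixSchrodinger.IsMoorePenroseInverse.unique {M X Y : Matrix (Fin n) (Fin n) ℂ}
    (hX : IsMoorePenroseInverse M X) (hY : IsMoorePenroseInverse M Y) : X = Y := by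
  have h1 : M * X = M * Y := by
    calc M * X = (M * Y) * (M * X) := by rw [← mul_assoc, hY.mul_mul_self]
      _ = (M * X * (M * Y))ᴴ := by
        rw [Matrix.conjTranspose_mul, hX.mul_hermitian, hY.mul_hermitian]
      _ = M * Y := by rw [← mul_assoc, hX.mul_mul_self, hY.mul_hermitian]
  have h2 : X * M = Y * M := by
    calc X * M = (X * M) * (Y * M) := by rw [mul_assoc, ← mul_assoc M, hY.mul_mul_self]
      _ = (Y * M * (X * M))ᴴ := by
        rw [Matrix.conjTranspose_mul, hX.inv_mul_hermitian, hY.inv_mul_hermitian]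
      _ = Y * M := by rw [mul_assoc, ← mul_assoc M, hX.mul_mul_self, hY.inv_mul_hermitian]
  rw [← hX.inv_mul_mul, h2, mul_assoc, h1, ← mul_assoc, hY.inv_mul_mul]

end DependencyMatrix

/-! ### The dependency matrix -/

theorem theorem4p1 {n : ℕ} (V : ℝ → Matrix (Fin n) (Fin n) ℂ)
    (hV_selfadjoint : ∀ x : ℝ, 0 < x → (V x).IsHermitian)
    (hV_integrable : MeasureTheory.IntegrableOn V (Set.Ioi 0))
    (A B : Matrix (Fin n) (Fin n) ℂ)
    (hAB_selfadjoint : -(Bᴴ * A) + Aᴴ * B = 0)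
    (hAB_pos : (Aᴴ * A + Bᴴ * B).PosDef)
    (κ : ℝ) (hκ : 0 < κ)
    (hbound : (jostMatrix V A B (Complex.I * κ)).det = 0) :
    (∃! D : Matrix (Fin n) (Fin n) ℂ, IsDependencyMatrix V A B κ D) ∧
    ∀ D : Matrix (Fin n) (Fin n) ℂ, IsDependencyMatrix V A B κ D →
      D = D * projQ V A B κ ∧
      (IsStarProjection (Dᴴ * D) ∧ Dᴴ * D = projQ V A B κ) ∧
      (IsStarProjection (D * Dᴴ) ∧ D * Dᴴ = projP V A B κ) ∧
      (D.rank = boundStateMultiplicity V A B κ ∧ Dᴴ.rank = boundStateMultiplicity V A B κ ∧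
        (projP V A B κ).rank = boundStateMultiplicity V A B κ ∧
        (projQ V A B κ).rank = boundStateMultiplicity V A B κ) ∧
      (∀ X : Matrix (Fin n) (Fin n) ℂ, IsMoorePenroseInverse D X ↔ X = Dᴴ) ∧
      (∀ x : ℝ, 0 ≤ x → marchenkoSolution V A B κ x = gelfandLevitanSolution V A B κ x * Dᴴ) ∧
      (D * Dᴴ * D = D ∧ Dᴴ * D * Dᴴ = Dᴴ) := by
  have hAB : Aᴴ * B = Bᴴ * A := by
    rw [neg_add_eq_zero] at hAB_selfadjoint
    exact hAB_selfadjoint.symm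
  have hf := isJostSolution_jostSolution hV_integrable hκ
  have hφ := isRegularSolution_regularSolution hV_integrable hκ A B
  have hφinj := fun R => regularSolution_injective (R := R) hV_integrable hκ hAB_pos
  obtain ⟨R, hPR, hφR⟩ := exists_regularSolution_mul_projQ_eq hV_integrable hV_selfadjoint hκ hAB
  have hP : IsStarProjection (projP V A B κ) := projectionMatrix_isStarProjection _
  have hQ : IsStarProjection (projQ V A B κ) := projectionMatrix_isStarProjection _
  have hPtr : (projP V A B κ).trace = boundStateMultiplicity V A B κ :=
    (trace_projectionMatrix _).trans (congrArg _ (finrank_matrixKernel_conjTranspose _))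
  have hQtr : (projQ V A B κ).trace = boundStateMultiplicity V A B κ := trace_projectionMatrix _
  have hPrk : (projP V A B κ).rank = boundStateMultiplicity V A B κ :=
    (rank_projectionMatrix _).trans (finrank_matrixKernel_conjTranspose _)
  have hQrk : (projQ V A B κ).rank = boundStateMultiplicity V A B κ := rank_projectionMatrix _
  set m := boundStateMultiplicity V A B κ
  set f := jostSolution V (Complex.I * κ)
  set φ := regularSolution V A B (Complex.I * κ)
  have hΨdef : ∀ x, marchenkoSolution V A B κ x =
      f x * ((CFC.sqrt (marchenkoGram V A B κ))⁻¹ * projP V A B κ) := fun x => rfl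
  have hΦdef : ∀ x, gelfandLevitanSolution V A B κ x =
      φ x * ((CFC.sqrt (gelfandLevitanGram V A B κ))⁻¹ * projQ V A B κ) := fun x => rfl
  have hBdef : marchenkoGram V A B κ = 1 - projP V A B κ + ∫ x in Set.Ioi (0 : ℝ),
    projP V A B κ * (f x)ᴴ * f x * projP V A B κ := rfl
  have hHdef : gelfandLevitanGram V A B κ = 1 - projQ V A B κ + ∫ x in Set.Ioi (0 : ℝ),
    projQ V A B κ * (φ x)ᴴ * φ x * projQ V A B κ := rfl
  have hdep : ∀ D, IsDependencyMatrix V A B κ D ↔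
    (∀ x : ℝ, 0 ≤ x → gelfandLevitanSolution V A B κ x = marchenkoSolution V A B κ x * D) ∧
      D = projP V A B κ * D := fun D => ⟨fun h => ⟨h.1, h.2⟩, fun h => ⟨h.1, h.2⟩⟩
  simp only [hdep, hΨdef, hΦdef]
  generalize projP V A B κ = P at *
  generalize projQ V A B κ = Q at *
  have hPs : Pᴴ = P := hP.isSelfAdjoint
  have hPP : P * P = P := hP.isIdempotentElem
  have hQs : Qᴴ = Q := hQ.isSelfAdjoint
  have hQQ : Q * Q = Q := hQ.isIdempotentElem
  have hK := hf.integrableOn_conjTranspose_mul hκ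
  set K := ∫ x in Set.Ioi (0 : ℝ), (f x)ᴴ * f x
  have hsand : ∀ S : Matrix (Fin n) (Fin n) ℂ,
      MeasureTheory.IntegrableOn (fun x => Sᴴ * ((f x)ᴴ * f x) * S) (Set.Ioi 0) ∧
      ∫ x in Set.Ioi (0 : ℝ), Sᴴ * ((f x)ᴴ * f x) * S = Sᴴ * K * S := fun S =>
    ⟨(hK.const_mul _).mul_const _, by
      rw [integral_mul_const_of_integrable (hK.const_mul _),
        integral_const_mul_of_integrable hK]⟩
  have hfP : ∀ x, P * (f x)ᴴ * f x * P = Pᴴ * ((f x)ᴴ * f x) * P := fun x => by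
    rw [hPs, mul_assoc P]
  -- Integrability of the integrand of 𝐇 is inherited from f through φQ = fR.
  have hφQ : Set.EqOn (fun x => Q * (φ x)ᴴ * φ x * Q) (fun x => Rᴴ * ((f x)ᴴ * f x) * R)
      (Set.Ioi 0) := fun x hx => by
    calc Q * (φ x)ᴴ * φ x * Q = (φ x * Q)ᴴ * (φ x * Q) := by
          rw [Matrix.conjTranspose_mul, hQs]; simp only [mul_assoc]
      _ = Rᴴ * ((f x)ᴴ * f x) * R := by
          rw [hφR x (le_of_lt hx), Matrix.conjTranspose_mul]; simp only [mul_assoc]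
  have hSP : ∫ x in Set.Ioi (0 : ℝ), P * (f x)ᴴ * f x * P = P * K * P := by
    simp only [hfP]
    rw [(hsand P).2, hPs]
  have hSQ : ∫ x in Set.Ioi (0 : ℝ), Q * (φ x)ᴴ * φ x * Q = Rᴴ * K * R := by
    rw [MeasureTheory.setIntegral_congr_fun measurableSet_Ioi hφQ, (hsand R).2]
  have hRQ : R * Q = R := sub_eq_zero.1 (hf.eq_zero_of_mul_eq_zero fun x hx => by
    rw [mul_sub, ← mul_assoc, ← hφR x hx, mul_assoc, hQQ, sub_self])
  have hQR : Q * Rᴴ = Rᴴ := by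
    have := congrArg Matrix.conjTranspose hRQ
    rwa [Matrix.conjTranspose_mul, hQs] at this
  obtain ⟨hB0, hBu⟩ := gram_nonneg_isUnit hP hf.isSolution.differentiableOn.continuousOn
    (by simp only [hfP]; exact (hsand P).1) fun R hR => hf.eq_zero_of_mul_eq_zero hR
  obtain ⟨hH0, hHu⟩ := gram_nonneg_isUnit hQ hφ.isSolution.differentiableOn.continuousOn
    ((hsand R).1.congr_fun hφQ.symm measurableSet_Ioi) fun R hR => hφinj _ hR
  rw [← hBdef] at hB0 hBu
  rw [← hHdef] at hH0 hHu
  rw [hSP] at hBdef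
  rw [hSQ] at hHdef
  obtain ⟨hbu, hPb, hPM, hMKM⟩ := normalization_properties hP hBdef
    (by rw [← mul_assoc, ← mul_assoc, hPP]) (by rw [mul_assoc, hPP]) hB0 hBu
  obtain ⟨-, -, hQC, hCKC⟩ := normalization_properties hQ hHdef
    (by rw [← mul_assoc, ← mul_assoc, hQR]) (by rw [mul_assoc, hRQ]) hH0 hHu
  set b := CFC.sqrt (marchenkoGram V A B κ)
  generalize (CFC.sqrt (gelfandLevitanGram V A B κ))⁻¹ * Q = C at hQC hCKC ⊢
  have hφC : ∀ x : ℝ, 0 ≤ x → φ x * C = f x * (R * C) := fun x hx => by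
    nth_rewrite 1 [← hQC]
    rw [← mul_assoc, hφR x hx, mul_assoc]
  generalize hMdef : b⁻¹ * P = M at hPM hMKM ⊢
  -- the defining property of a dependency matrix, without the variable `x`
  have hchar : ∀ D, ((∀ x : ℝ, 0 ≤ x → φ x * C = f x * M * D) ∧ D = P * D) ↔
      M * D = R * C ∧ D = P * D := fun D => and_congr_left fun _ => by
    constructor
    · intro h
      refine sub_eq_zero.1 (hf.eq_zero_of_mul_eq_zero fun x hx => ?_)
      rw [mul_sub, ← mul_assoc, ← h x hx, hφC x hx, sub_self]
    · intro h x hx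
      rw [hφC x hx, mul_assoc, h]
  have hbM : b * M = P := by rw [← hMdef, ← mul_assoc, Matrix.mul_nonsing_inv _ hbu, one_mul]
  -- Multiplying MD = RC by b = 𝐁^{1/2} gives D, as bM = P. Conversely, b commutes with P and PR =
  -- R, so b(RC) lies in the range of P.
  have hsolve : ∀ D, (M * D = R * C ∧ D = P * D) ↔ D = b * (R * C) := fun D => by
    constructor
    · rintro ⟨h, hD⟩
      rw [← h, ← mul_assoc, hbM, ← hD]
    · rintro rfl
      have hPD : P * (b * (R * C)) = b * (R * C) := by
        rw [← mul_assoc, hPb, mul_assoc, ← mul_assoc P, hPR]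
      refine ⟨?_, hPD.symm⟩
      rw [← hMdef, mul_assoc, hPD, ← mul_assoc, Matrix.nonsing_inv_mul _ hbu, one_mul]
  refine ⟨⟨b * (R * C), (hchar _).2 ((hsolve _).2 rfl), fun D hD =>
    (hsolve D).1 ((hchar D).1 hD)⟩, fun D hD => ?_⟩
  have hΦΨ := hD.1
  obtain ⟨hMD, hPD⟩ := (hchar D).1 hD
  -- M = PM allows PKP to be replaced by K, so the normalization applies to the full Gram integral.
  have hMM : Mᴴ * K * M = P := by
    calc Mᴴ * K * M = (P * M)ᴴ * K * (P * M) := by rw [hPM]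
      _ = Mᴴ * (P * K * P) * M := by
          rw [Matrix.conjTranspose_mul, hPs]; simp only [mul_assoc]
      _ = P := hMKM
  have hDD : Dᴴ * D = Q := by
    calc Dᴴ * D = Dᴴ * (Mᴴ * K * M * D) := by rw [hMM, ← hPD]
      _ = (M * D)ᴴ * K * (M * D) := by
          rw [Matrix.conjTranspose_mul]; simp only [mul_assoc]
      _ = Cᴴ * (Rᴴ * K * R) * C := by
          rw [hMD, Matrix.conjTranspose_mul]; simp only [mul_assoc]
      _ = Q := hCKC
  have hDQ : D * Q = D := by
    refine (sub_eq_zero.1 (Matrix.conjTranspose_mul_self_eq_zero.1 ?_)).symm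
    rw [Matrix.conjTranspose_sub, Matrix.conjTranspose_mul, hQs, sub_mul, mul_sub, mul_sub,
      mul_assoc Q, ← mul_assoc Dᴴ, mul_assoc Q, ← mul_assoc Dᴴ, hDD, hQQ, hQQ]
    simp
  have hQD : Q * Dᴴ = Dᴴ := by
    have := congrArg Matrix.conjTranspose hDQ
    rwa [Matrix.conjTranspose_mul, hQs] at this
  have hDP : Dᴴ * P = Dᴴ := by
    have := congrArg Matrix.conjTranspose hPD
    rw [Matrix.conjTranspose_mul, hPs] at this
    exact this.symm
  -- E = P - DD† satisfies E†E = E, and tr DD† = tr D†D = tr Q = tr P; so E†E has trace zero and E =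
  -- 0.
  have hDDP : D * Dᴴ = P := by
    have hE : (P - D * Dᴴ)ᴴ * (P - D * Dᴴ) = P - D * Dᴴ := by
      rw [Matrix.conjTranspose_sub, Matrix.conjTranspose_mul, Matrix.conjTranspose_conjTranspose,
        hPs, sub_mul, mul_sub, mul_sub, hPP, ← mul_assoc P, ← hPD, mul_assoc D, hDP, mul_assoc D,
        ← mul_assoc Dᴴ, hDD, hQD]
      simp
    have htr : (P - D * Dᴴ).trace = 0 := by
      rw [Matrix.trace_sub, Matrix.trace_mul_comm, hDD, hPtr, hQtr, sub_self]
    rw [← hE, Matrix.trace_conjTranspose_mul_self_eq_zero_iff] at htr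
    exact (sub_eq_zero.1 htr).symm
  have hDrk : D.rank = m := by rw [← Matrix.rank_conjTranspose_mul_self, hDD, hQrk]
  have hDDD : D * Dᴴ * D = D := by rw [mul_assoc, hDD, hDQ]
  have hDDD' : Dᴴ * D * Dᴴ = Dᴴ := by rw [hDD, hQD]
  have hMP : IsMoorePenroseInverse D Dᴴ :=
    ⟨hDDD, hDDD', by rw [hDDP, hPs], by rw [hDD, hQs]⟩
  refine ⟨hDQ.symm, ⟨hDD ▸ hQ, hDD⟩, ⟨hDDP ▸ hP, hDDP⟩,
    ⟨hDrk, by rw [Matrix.rank_conjTranspose, hDrk], hPrk, hQrk⟩, fun X => ⟨fun h => ?_, ?_⟩,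
    fun x hx => ?_, hDDD, hDDD'⟩
  · exact h.unique hMP
  · rintro rfl
    exact hMP
  · rw [hΦΨ x hx, mul_assoc, hDDP, mul_assoc]
    congr 1
    rw [← hMdef, mul_assoc, hPP]
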